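/- Let $k$ be a perfect field of characteristic $p>0$, let $G$ be a finite group, let $\rho\colon G\to\operatorname{Aut}_k k[[t]]$ be an injective homomorphism to the group of $k$-algebra automorphisms, and let $N$ be a normal subgroup of $G$. **Notation.** Put $\mathrm{Der}=\mathrm{Der}_k(k[[t]])$, $\mathrm{Der}^\sharp=\mathrm{Der}_k(k[[t]]^N)$ and $\mathrm{Der}_1=\mathrm{Der}_k(k[[t]]^N,k[[t]])$. The group $G$ acts on $\mathrm{Der}$ by $d^g=\rho(g)\,d\,\rho(g)^{-1}$, and on $\mathrm{Der}_1$ and $\mathrm{Der}^\sharp$ by the same formula (on $k[[t]]^N$ through the induced action of $G/N$). Restriction to $k[[t]]^N$ and extension of the target give $G$-equivariant maps $\mathrm{Der}\to\mathrm{Der}_1$ and $\mathrm{Der}^\sharp\to\mathrm{Der}_1$, which we suppress from the notation, and restriction gives an injection of $G/N$-modules $\mathrm{Der}^N\hookrightarrow\mathrm{Der}^\sharp$. Let $j_*\colon H^1(G/N,\mathrm{Der}^N)\to H^1(G/N,\mathrm{Der}^\sharp)$, $\sigma\colon H^1(G/N,\mathrm{Der}^\sharp)\to H^1(G/N,\mathrm{Der}^\sharp/\mathrm{Der}^N)$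 and the connecting map $\partial\colon H^1(G/N,\mathrm{Der}^\sharp/\mathrm{Der}^N)\to H^2(G/N,\mathrm{Der}^N)$ come from $$0\to\mathrm{Der}^N\to\mathrm{Der}^\sharp\to\mathrm{Der}^\sharp/\mathrm{Der}^N\to0 .$$ *The transgression* $\mathrm{tg}\colon H^1(N,\mathrm{Der})^{G/N}\to H^2(G/N,\mathrm{Der}^N)$ sends $[d]$ to $[c]$, where $b\colon G\to\mathrm{Der}$ is a map that extends the cocycle $d$ and satisfies $b_{sg}=b_g^s+b_s$, $b_{gs}=b_s^g+b_g$ for $s\in N$, $g\in G$, and $c$ is the $2$-cocycle whose inflation to $G$ is $(g,h)\mapsto b_h^g-b_{gh}+b_g$. *The map* $\mathrm{ind}\colon H^1(G,\mathrm{Der})\to H^1(G/N,\mathrm{Der}^\sharp)$. Let $A=k[\varepsilon]$ with $\varepsilon^2=0$. The group $H^1(G,\mathrm{Der})$ is identified with the set of lifts $\rho_A\colon G\to\operatorname{Aut}_A A[[t]]$ of $\rho$, modulo conjugation by automorphisms that reduce to the identity modulo $\varepsilon$; the lift $\rho_A(g)(x)=\rho(g)(x)+\varepsilon\, d_g(\rho(g)(x))$,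 $x\in k[[t]]$, corresponds to the class of the cocycle $d$. The same holds for $G/N$ acting on $k[[t]]^N=k[[y]]$, $y=\prod_{s\in N}\rho(s)(t)$. The map $\mathrm{ind}$ sends the class of $\rho_A$ to the class of the action of $G/N$ induced by $\rho_A$ on $A[[t]]^N$, where $A[[t]]^N$ is identified with $A[[y]]$ by $y\mapsto\prod_{s\in N}\rho_A(s)(t)$. **Theorem.** 1. The sequence $$0\to H^1(G/N,\mathrm{Der}^N)\xrightarrow{\inf}H^1(G,\mathrm{Der})\xrightarrow{\mathrm{res}}H^1(N,\mathrm{Der})^{G/N}\xrightarrow{\mathrm{tg}}H^2(G/N,\mathrm{Der}^N)\xrightarrow{\inf}H^2(G,\mathrm{Der})$$ and the sequence $$H^1(G/N,\mathrm{Der}^N)\xrightarrow{j_*}H^1(G/N,\mathrm{Der}^\sharp)\xrightarrow{\sigma}H^1(G/N,\mathrm{Der}^\sharp/\mathrm{Der}^N)\xrightarrow{\partial}H^2(G/N,\mathrm{Der}^N)$$ are exact, and $\mathrm{ind}$ is $k$-linear. 2. For every cocycle $d\colon N\to\mathrm{Der}$ there is $\alpha\in\mathrm{Der}_1$ with $d_s=\alpha^s-\alpha$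 for all $s\in N$. If the class $[d]\in H^1(N,\mathrm{Der})$ is $G/N$-invariant, then for every such $\alpha$ there are maps $a\colon G\to\mathrm{Der}^\sharp$ and $b\colon G\to\mathrm{Der}$ with $\alpha^g-\alpha=a_g+b_g$ for all $g\in G$. 3. There is a $k$-linear map $\gamma\colon H^1(N,\mathrm{Der})^{G/N}\to H^1(G/N,\mathrm{Der}^\sharp/\mathrm{Der}^N)$ such that, for every cocycle $d$ with $G/N$-invariant class and all $\alpha,a,b$ as in 2, the class $\bar a_g$ of $a_g$ in $\mathrm{Der}^\sharp/\mathrm{Der}^N$ depends only on $\bar g=gN$, the map $\bar g\mapsto\bar a_g$ is a cocycle, and $$\gamma([d])=-[\bar a],$$ and such that the diagram formed by the two sequences and the maps $\mathrm{id}$, $\mathrm{ind}$, $\gamma$, $\mathrm{id}$ commutes: $$\mathrm{ind}\circ\inf=j_*,\qquad \sigma\circ\mathrm{ind}=\gamma\circ\mathrm{res},\qquad \mathrm{tg}=\partial\circ\gamma .$$ -/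

import Mathlib

open scoped PowerSeries DualNumber

universe u

namespace LocalAction

section Fixed

variable {k G B : Type*} [Field k] [Group G] [CommRing B] [Algebra k B]

/-- The subalgebra `B^N` of elements fixed by the subgroup `N`. -/
def fixed (ρ : G →* (B ≃ₐ[k] B)) (N : Subgroup G) : Subalgebra k B where
  carrier := {x | ∀ s ∈ N, ρ s x = x}
  mul_mem' hx hy s hs := by rw [map_mul, hx s hs, hy s hs]
  add_mem' hx hy s hs := by rw [map_add, hx s hs, hy s hs]
  algebraMap_mem' r s _ := (ρ s).commutes r

theorem apply_mem_fixed (ρ : G →* (B ≃ₐ[k] B)) (N : Subgroup G) [N.Normal] (g : G) {x : B}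
    (hx : x ∈ fixed ρ N) : ρ g x ∈ fixed ρ N := by
  intro s hs
  have h : s * g = g * (g⁻¹ * s * g) := by group
  rw [← AlgEquiv.mul_apply, ← map_mul, h, map_mul, AlgEquiv.mul_apply,
    hx _ (Subgroup.Normal.conj_mem' ‹_› s hs g)]

/-- The action of `G / N` on `B^N` induced by an action of `G` on `B`. -/
def quotientAction (ρ : G →* (B ≃ₐ[k] B)) (N : Subgroup G) [N.Normal] :
    G ⧸ N →* (fixed ρ N ≃ₐ[k] fixed ρ N) :=
  QuotientGroup.lift N
    { toFun := fun g => AlgEquiv.ofAlgHom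
        (((ρ g).toAlgHom.comp (fixed ρ N).val).codRestrict (fixed ρ N)
          fun x => apply_mem_fixed ρ N g x.2)
        (((ρ g⁻¹).toAlgHom.comp (fixed ρ N).val).codRestrict (fixed ρ N)
          fun x => apply_mem_fixed ρ N g⁻¹ x.2)
        (by ext x; change ρ g (ρ g⁻¹ x) = x; rw [← AlgEquiv.mul_apply, ← map_mul]; simp)
        (by ext x; change ρ g⁻¹ (ρ g x) = x; rw [← AlgEquiv.mul_apply, ← map_mul]; simp)
      map_one' := by ext x; change ρ 1 (x : B) = x; simp
      map_mul' := fun g h => by ext x; change ρ (g * h) (x : B) = ρ g (ρ h x); simp }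
    (fun s hs => by ext x; exact x.2 s hs)

@[simp] theorem coe_quotientAction (ρ : G →* (B ≃ₐ[k] B)) (N : Subgroup G) [N.Normal] (g : G)
    (x : fixed ρ N) : (quotientAction ρ N (g : G ⧸ N) x : B) = ρ g x := rfl

end Fixed

section PowerSeries

open PowerSeries

variable {k : Type*} [Field k]

theorem psHom_ext {C : Type*} [CommRing C] [Algebra k C] {ψ₁ ψ₂ : k⟦X⟧ →ₐ[k] C}
    (hX : ψ₁ X = ψ₂ X) (hC : ∀ c : C, (∀ m : ℕ, ψ₁ X ^ m ∣ c) → c = 0) : ψ₁ = ψ₂ := by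
  have hpol : ∀ p : Polynomial k, ψ₁ (p : k⟦X⟧) = ψ₂ (p : k⟦X⟧) := fun p => by
    have h : ψ₁.comp (Polynomial.coeToPowerSeries.algHom k) =
        ψ₂.comp (Polynomial.coeToPowerSeries.algHom k) :=
      Polynomial.algHom_ext (by simpa [Polynomial.coeToPowerSeries.algHom_apply] using hX)
    simpa [Polynomial.coeToPowerSeries.algHom_apply] using DFunLike.congr_fun h p
  ext f
  refine sub_eq_zero.1 (hC _ fun m => ?_)
  obtain ⟨q, hq⟩ : (X : k⟦X⟧) ^ m ∣ f - (trunc m f : k⟦X⟧) := by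
    rw [X_pow_dvd_iff]
    intro i hi
    simp [coeff_trunc, hi]
  have hf : f = (trunc m f : k⟦X⟧) + X ^ m * q := by rw [← hq]; ring
  rw [hf]
  simp only [map_add, map_mul, map_pow, hpol, ← hX]
  exact ⟨ψ₁ q - ψ₂ q, by ring⟩

theorem eq_zero_of_pow_dvd {y c : k⟦X⟧} (hy : X ∣ y) (h : ∀ m : ℕ, y ^ m ∣ c) : c = 0 := by
  ext n
  exact X_pow_dvd_iff.1 ((pow_dvd_pow_of_dvd hy (n + 1)).trans (h (n + 1))) n (Nat.lt_succ_self n)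

variable {G : Type*} [Group G] (ρ : G →* (k⟦X⟧ ≃ₐ[k] k⟦X⟧))

theorem X_dvd_apply_X (g : G) : X ∣ ρ g X := by
  have h : ¬ IsUnit (ρ g X) := by
    rw [MulEquiv.isUnit_map]
    exact X_prime.not_isUnit
  rw [X_dvd_iff]
  by_contra h0
  exact h (isUnit_iff_constantCoeff.2 (isUnit_iff_ne_zero.2 h0))

theorem apply_X_dvd_X (g : G) : ρ g X ∣ X := by
  obtain ⟨c, hc⟩ := X_dvd_apply_X ρ g⁻¹
  refine ⟨ρ g c, ?_⟩
  rw [← map_mul, ← hc, ← AlgEquiv.mul_apply, ← map_mul]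
  simp

/-- The norm `y = ∏_{s ∈ N} ρ(s)(t)` of the variable `t = X`. -/
noncomputable def normX (N : Subgroup G) : k⟦X⟧ := ∏ᶠ s : N, ρ s X

variable (N : Subgroup G)

theorem normX_mem [Finite G] : normX ρ N ∈ fixed ρ N := by
  classical
  have := Fintype.ofFinite N
  intro s hs
  rw [normX, finprod_eq_prod_of_fintype, map_prod]
  refine Fintype.prod_equiv (Equiv.mulLeft (⟨s, hs⟩ : N)) _ _ fun x => ?_
  rw [← AlgEquiv.mul_apply, ← map_mul]
  rfl

theorem associated_normX [Finite G] : Associated (X ^ Nat.card N : k⟦X⟧) (normX ρ N) := by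
  classical
  have := Fintype.ofFinite N
  rw [normX, finprod_eq_prod_of_fintype, Nat.card_eq_fintype_card, ← Finset.card_univ,
    ← Finset.prod_const]
  exact Associated.prod _ _ _ fun s _ => associated_of_dvd_dvd (X_dvd_apply_X ρ s) (apply_X_dvd_X ρ s)

theorem X_dvd_normX [Finite G] : X ∣ normX ρ N :=
  (dvd_pow_self X Nat.card_pos.ne').trans (associated_normX ρ N).dvd

theorem normX_ne_zero [Finite G] : normX ρ N ≠ 0 :=
  (associated_normX ρ N).ne_zero_iff.1 (pow_ne_zero _ X_ne_zero)

theorem hasSubst_normX [Finite G] : HasSubst (normX ρ N) :=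
  HasSubst.of_constantCoeff_zero' (X_dvd_iff.1 (X_dvd_normX ρ N))

/-- The `k`-algebra homomorphism `k⟦X⟧ → k⟦X⟧`, `f ↦ f(y)`, where `y = ∏_{s ∈ N} ρ(s)(t)`. -/
noncomputable def substNormX [Finite G] : k⟦X⟧ →ₐ[k] k⟦X⟧ := substAlgHom (hasSubst_normX ρ N)

@[simp] theorem substNormX_X [Finite G] : substNormX ρ N X = normX ρ N := substAlgHom_X _

theorem substNormX_injective [Finite G] : Function.Injective (substNormX ρ N) := by
  rw [injective_iff_map_eq_zero]
  intro f hf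
  by_contra h0
  obtain ⟨n, u, rfl⟩ := IsDiscreteValuationRing.eq_unit_mul_pow_irreducible h0
    (X_prime (R := k)).irreducible
  rw [map_mul, map_pow, substNormX_X] at hf
  exact mul_ne_zero (u.isUnit.map (substNormX ρ N)).ne_zero
    (pow_ne_zero n (normX_ne_zero ρ N)) hf

theorem substNormX_mem [Finite G] (f : k⟦X⟧) : substNormX ρ N f ∈ fixed ρ N := by
  intro s hs
  have h : ((ρ s).toAlgHom.comp (substNormX ρ N)) = substNormX ρ N := by
    refine psHom_ext ?_ fun c hc => eq_zero_of_pow_dvd ?_ hc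
    · simpa using normX_mem ρ N s hs
    · change X ∣ ρ s (substNormX ρ N X)
      rw [substNormX_X, normX_mem ρ N s hs]
      exact X_dvd_normX ρ N
  exact DFunLike.congr_fun h f

theorem exists_eq_sum [Finite G] (f : k⟦X⟧) :
    ∃ c : ℕ → k⟦X⟧, f = ∑ i ∈ Finset.range (Nat.card N), substNormX ρ N (c i) * X ^ i := by
  obtain ⟨w, hw⟩ := (associated_normX ρ N).symm.dvd
  set n := Nat.card N
  let T : k⟦X⟧ → k⟦X⟧ := fun f => w * mk fun i => coeff (i + n) f
  have hT : ∀ f, f = ∑ i ∈ Finset.range n, C (coeff i f) * X ^ i + normX ρ N * T f := by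
    intro f
    conv_lhs => rw [eq_X_pow_mul_shift_add_trunc n f, hw, add_comm, mul_assoc]
    congr 1
    ext j
    simp [coeff_trunc, coeff_C_mul, coeff_X_pow]
  let c : k⟦X⟧ → ℕ → k⟦X⟧ := fun f i => mk fun j => coeff i (T^[j] f)
  have hc : ∀ f i, c f i = C (coeff i f) + X * c (T f) i := by
    intro f i
    ext j
    rcases j with _ | j
    · simp [c]
    · simp [c, coeff_succ_X_mul]
  refine ⟨c f, sub_eq_zero.1 (eq_zero_of_pow_dvd (X_dvd_normX ρ N) fun m => ?_)⟩
  induction m generalizing f with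
  | zero => simp
  | succ m ih =>
    obtain ⟨q, hq⟩ := ih (T f)
    refine ⟨q, ?_⟩
    rw [pow_succ', mul_assoc, ← hq]
    have hC : ∀ a : k, substNormX ρ N (C a) = C a := (substNormX ρ N).commutes
    have hS : ∑ i ∈ Finset.range n, substNormX ρ N (c f i) * X ^ i =
        ∑ i ∈ Finset.range n, C (coeff i f) * X ^ i +
          normX ρ N * ∑ i ∈ Finset.range n, substNormX ρ N (c (T f) i) * X ^ i := by
      rw [Finset.mul_sum, ← Finset.sum_add_distrib]
      refine Finset.sum_congr rfl fun i _ => ?_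
      rw [hc f i, map_add, map_mul, substNormX_X, hC]
      ring
    rw [hS, mul_sub]
    linear_combination hT f

theorem apply_X_injective (hρ : Function.Injective ρ) : Function.Injective fun g => ρ g X := by
  intro g h hgh
  refine hρ (AlgEquiv.coe_toAlgHom_injective (psHom_ext hgh fun c hc => eq_zero_of_pow_dvd ?_ hc))
  exact X_dvd_apply_X ρ g

theorem exists_substNormX_eq [Finite G] (hρ : Function.Injective ρ) {f : k⟦X⟧}
    (hf : f ∈ fixed ρ N) : ∃ c, substNormX ρ N c = f := by
  classical
  have := Fintype.ofFinite N
  obtain ⟨c, hc⟩ := exists_eq_sum ρ N f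
  refine ⟨c 0, ?_⟩
  have hn : 0 < Nat.card N := Nat.card_pos
  let Q : Polynomial k⟦X⟧ :=
    ∑ i ∈ Finset.range (Nat.card N), Polynomial.C (substNormX ρ N (c i)) * Polynomial.X ^ i
      - Polynomial.C f
  have hQ : Q = 0 := by
    refine Polynomial.eq_zero_of_natDegree_lt_card_of_eval_eq_zero Q
      (f := fun s : N => ρ s X) (fun a b h => Subtype.ext (apply_X_injective ρ hρ h)) ?_ ?_
    · intro s
      have := congrArg (ρ s) hc
      rw [hf s s.2, map_sum] at this
      simp only [map_mul, map_pow, substNormX_mem ρ N (c _) s s.2] at this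
      simp only [Q, Polynomial.eval_sub, Polynomial.eval_finsetSum, Polynomial.eval_mul,
        Polynomial.eval_C, Polynomial.eval_pow, Polynomial.eval_X]
      rw [← this, sub_self]
    · rw [← Nat.card_eq_fintype_card]
      refine lt_of_le_of_lt (Polynomial.natDegree_sub_le_of_le (m := Nat.card N - 1) (n := 0)
        (Polynomial.natDegree_sum_le_of_forall_le _ _ fun i hi => ?_)
        (Polynomial.natDegree_C f).le) ?_
      · exact (Polynomial.natDegree_C_mul_X_pow_le _ _).trans
          (Nat.le_pred_of_lt (Finset.mem_range.1 hi))
      · simpa using hn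
  have := congrArg (Polynomial.coeff · 0) hQ
  simp only [Q, Polynomial.coeff_sub, Polynomial.finsetSum_coeff, Polynomial.coeff_C_mul,
    Polynomial.coeff_X_pow, Polynomial.coeff_zero, Polynomial.coeff_C_zero] at this
  simpa [sub_eq_zero, Fintype.card_pos] using this

/-- The isomorphism `k⟦X⟧ ≃ k⟦X⟧^N`, `f ↦ f(y)`, where `y = ∏_{s ∈ N} ρ(s)(t)`. -/
noncomputable def fixedEquiv [Finite G] (hρ : Function.Injective ρ) : k⟦X⟧ ≃ₐ[k] fixed ρ N :=
  AlgEquiv.ofBijective ((substNormX ρ N).codRestrict (fixed ρ N) (substNormX_mem ρ N))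
    ⟨fun f g h => substNormX_injective ρ N (congrArg Subtype.val h), fun f => by
      obtain ⟨c, hc⟩ := exists_substNormX_eq ρ N hρ f.2
      exact ⟨c, Subtype.ext hc⟩⟩

end PowerSeries


section Derivations

variable {k G B C : Type*} [Field k] [Group G] [CommRing B] [Algebra k B] [CommRing C]
  [Algebra k C] [Algebra C B]

/-- The linear map `α ↦ s ∘ α ∘ r⁻¹` on `k`-derivations `C → B`, for compatible automorphisms
`r` of `C` and `s` of `B`. -/
def conjDer (r : C ≃ₐ[k] C) (s : B ≃ₐ[k] B)
    (h : ∀ c, s (algebraMap C B c) = algebraMap C B (r c)) :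
    Derivation k C B →ₗ[k] Derivation k C B where
  toFun α := Derivation.mk' (s.toLinearMap ∘ₗ (α : C →ₗ[k] B) ∘ₗ r.symm.toLinearMap) fun a b => by
    simp [Algebra.smul_def, h]
  map_add' α β := by ext; simp
  map_smul' c α := by ext; simp

@[simp] theorem conjDer_apply (r : C ≃ₐ[k] C) (s : B ≃ₐ[k] B)
    (h : ∀ c, s (algebraMap C B c) = algebraMap C B (r c)) (α : Derivation k C B) (x : C) :
    conjDer r s h α x = s (α (r.symm x)) := rfl

/-- `Der_k B` as a representation of `G`: `d^g = ρ(g) ∘ d ∘ ρ(g)⁻¹`. -/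
def derRep (ρ : G →* (B ≃ₐ[k] B)) : Representation k G (Derivation k B B) where
  toFun g := conjDer (ρ g) (ρ g) fun _ => rfl
  map_one' := by ext d x; simp; rfl
  map_mul' g h := by ext d x; simp [AlgEquiv.mul_apply]; rfl

@[simp] theorem derRep_apply (ρ : G →* (B ≃ₐ[k] B)) (g : G) (d : Derivation k B B) (x : B) :
    derRep ρ g d x = ρ g (d ((ρ g).symm x)) := rfl

end Derivations

section Lifts

open TrivSqZeroExt

variable {k G B : Type*} [Field k] [Group G] [CommRing B] [Algebra k B]

/-- A lift to `k[ε]` of an action `ρ` of `G` on the `k`-algebra `B`: an action of `G` on `B[ε]` by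
automorphisms of `k[ε]`-algebras that reduces to `ρ` modulo `ε`.
(For `B = k⟦t⟧`, the ring `B[ε]` is the power series ring `k[ε]⟦t⟧`.) -/
@[ext]
structure Lift (ρ : G →* (B ≃ₐ[k] B)) where
  hom : G →* (B[ε] ≃ₐ[k] B[ε])
  map_eps : ∀ g, hom g ε = ε
  fst_hom : ∀ g x, (hom g x).fst = ρ g x.fst

/-- Two lifts are equivalent if they are conjugate by an automorphism `χ` of the `k[ε]`-algebra
`B[ε]` that reduces to the identity modulo `ε`. -/
def Lift.setoid (ρ : G →* (B ≃ₐ[k] B)) : Setoid (Lift ρ) where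
  r σ σ' := ∃ χ : B[ε] ≃ₐ[k] B[ε], χ ε = ε ∧ (∀ x, (χ x).fst = x.fst) ∧
    ∀ g, σ'.hom g = χ * σ.hom g * χ⁻¹
  iseqv :=
    { refl := fun σ => ⟨1, rfl, fun _ => rfl, fun g => by simp⟩
      symm := by
        rintro σ σ' ⟨χ, h1, h2, h3⟩
        refine ⟨χ⁻¹, ?_, fun x => ?_, fun g => ?_⟩
        · exact χ.symm_apply_eq.2 h1.symm
        · have := h2 (χ.symm x)
          rw [χ.apply_symm_apply] at this
          exact this.symm
        · rw [h3 g]; group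
      trans := by
        rintro σ σ' σ'' ⟨χ, h1, h2, h3⟩ ⟨χ', h1', h2', h3'⟩
        refine ⟨χ' * χ, ?_, fun x => ?_, fun g => ?_⟩
        · rw [AlgEquiv.mul_apply, h1, h1']
        · rw [AlgEquiv.mul_apply, h2', h2]
        · rw [h3', h3]; group }

/-- The tangent space `D_ρ(k[ε])` of the deformation functor of `ρ`: equivalence classes of lifts
of `ρ` to `k[ε]`. -/
def Deformation (ρ : G →* (B ≃ₐ[k] B)) : Type _ := Quotient (Lift.setoid ρ)

theorem eq_inl_add (x : B[ε]) : x = inl x.fst + inl x.snd * ε := by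
  ext <;> simp

theorem inl_mul_eps_eq (x : B) : (inl x * ε : B[ε]) = inr x := by
  ext <;> simp

theorem snd_apply_of_fix (θ : B[ε] →ₐ[k] B[ε]) (hθ : θ ε = ε) (w : B[ε]) :
    (θ w).snd = (θ (inl w.fst)).snd + (θ (inl w.snd)).fst := by
  conv_lhs => rw [eq_inl_add w, map_add, map_mul, hθ]
  simp

/-- The automorphism `x + ε z ↦ r x + ε (r z + d (r x))` of the `k[ε]`-algebra `B[ε]`, i.e. the
composite of (the `k[ε]`-linear extension of) `r` and of `1 + ε d`. -/
def liftAut (r : B ≃ₐ[k] B) (d : Derivation k B B) : B[ε] ≃ₐ[k] B[ε] where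
  toFun w := inl (r w.fst) + inr (r w.snd + d (r w.fst))
  invFun w := inl (r.symm w.fst) + inr (r.symm (w.snd - d w.fst))
  left_inv w := by ext <;> simp
  right_inv w := by ext <;> simp
  map_mul' v w := by
    ext
    · simp
    · simp; ring
  map_add' v w := by
    ext
    · simp
    · simp; ring
  commutes' a := by ext <;> simp [TrivSqZeroExt.algebraMap_eq_inl']

@[simp] theorem fst_liftAut (r : B ≃ₐ[k] B) (d : Derivation k B B) (w : B[ε]) :
    (liftAut r d w).fst = r w.fst := by simp [liftAut]

@[simp] theorem snd_liftAut (r : B ≃ₐ[k] B) (d : Derivation k B B) (w : B[ε]) :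
    (liftAut r d w).snd = r w.snd + d (r w.fst) := by simp [liftAut]

/-- The derivation `d` such that `θ (x) = r x + ε d (r x)` for `x ∈ B`. -/
def derOfAut (r : B ≃ₐ[k] B) (θ : B[ε] ≃ₐ[k] B[ε]) (hθ : ∀ x, (θ x).fst = r x.fst) :
    Derivation k B B :=
  Derivation.mk' ((sndHom B B).restrictScalars k ∘ₗ θ.toLinearMap ∘ₗ
      (inlAlgHom k B B).toLinearMap ∘ₗ r.symm.toLinearMap) fun a b => by
    simp [hθ, mul_comm b]

@[simp] theorem derOfAut_apply (r : B ≃ₐ[k] B) (θ : B[ε] ≃ₐ[k] B[ε])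
    (hθ : ∀ x, (θ x).fst = r x.fst) (x : B) :
    derOfAut r θ hθ x = (θ (inl (r.symm x))).snd := rfl

theorem liftAut_derOfAut (r : B ≃ₐ[k] B) (θ : B[ε] ≃ₐ[k] B[ε])
    (hθ : ∀ x, (θ x).fst = r x.fst) (he : θ ε = ε) : liftAut r (derOfAut r θ hθ) = θ := by
  ext w
  · simp [hθ]
  · have := snd_apply_of_fix θ.toAlgHom he w
    change (θ w).snd = (θ _).snd + (θ _).fst at this
    rw [this, hθ]
    simp [add_comm]

end Lifts

section Tangent

open TrivSqZeroExt groupCohomology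

variable {k G B : Type u} [Field k] [Group G] [CommRing B] [Algebra k B]

/-- The `G`-module `Der_k B`. -/
abbrev Der (ρ : G →* (B ≃ₐ[k] B)) : Rep k G := Rep.of (derRep ρ)

/-- The 1-cocycle `d` of a lift `σ`: `σ(g)(x) = ρ(g)(x) + ε d_g(ρ(g)(x))` for `x ∈ B`. -/
def Lift.cocycle {ρ : G →* (B ≃ₐ[k] B)} (σ : Lift ρ) : cocycles₁ (Der ρ) :=
  ⟨fun g => derOfAut (ρ g) (σ.hom g) (σ.fst_hom g), by
    rw [mem_cocycles₁_iff]
    intro g h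
    ext x
    have h1 := snd_apply_of_fix (σ.hom g).toAlgHom (σ.map_eps g)
      (σ.hom h (inl ((ρ (g * h)).symm x)))
    change (σ.hom g _).snd = (σ.hom g _).snd + (σ.hom g _).fst at h1
    have h2 : (ρ h) ((ρ (g * h)).symm x) = (ρ g).symm x := by
      rw [AlgEquiv.eq_symm_apply, ← AlgEquiv.mul_apply, ← map_mul, AlgEquiv.apply_symm_apply]
    have h3 : (ρ (g * h)).symm x = (ρ h).symm ((ρ g).symm x) := by
      rw [AlgEquiv.eq_symm_apply, h2]
    change (σ.hom (g * h) (inl ((ρ (g * h)).symm x))).snd =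
      ρ g (σ.hom h (inl ((ρ h).symm ((ρ g).symm x)))).snd + (σ.hom g (inl ((ρ g).symm x))).snd
    rw [map_mul, AlgEquiv.mul_apply, h1, σ.fst_hom, σ.fst_hom, fst_inl, fst_inl, h2, h3, add_comm]⟩

theorem Lift.liftAut_cocycle {ρ : G →* (B ≃ₐ[k] B)} (σ : Lift ρ) (g : G) :
    liftAut (ρ g) (σ.cocycle g) = σ.hom g :=
  liftAut_derOfAut _ _ (σ.fst_hom g) (σ.map_eps g)

/-- The lift `x ↦ ρ(g)(x) + ε d_g(ρ(g)(x))` given by a 1-cocycle `d`. -/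
def liftOfCocycle {ρ : G →* (B ≃ₐ[k] B)} (d : cocycles₁ (Der ρ)) : Lift ρ where
  hom :=
    { toFun := fun g => liftAut (ρ g) (d g)
      map_one' := by
        rw [cocycles₁_map_one]
        ext w <;> simp
      map_mul' := fun g h => by
        rw [(mem_cocycles₁_iff d).1 d.2 g h]
        ext w
        · simp
        · simp [AlgEquiv.mul_apply]
          abel }
  map_eps g := by ext <;> simp
  fst_hom g x := fst_liftAut _ _ x

theorem cocycle_liftOfCocycle {ρ : G →* (B ≃ₐ[k] B)} (d : cocycles₁ (Der ρ)) :
    (liftOfCocycle d).cocycle = d := by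
  ext g x
  change (liftAut (ρ g) (d g) (inl ((ρ g).symm x))).snd = d g x
  simp

theorem Lift.equiv_iff {ρ : G →* (B ≃ₐ[k] B)} (σ σ' : Lift ρ) :
    Lift.setoid ρ σ σ' ↔ H1π (Der ρ) σ.cocycle = H1π (Der ρ) σ'.cocycle := by
  rw [H1π_eq_iff]
  constructor
  · rintro ⟨χ, h1, h2, h3⟩
    have hχ := liftAut_derOfAut 1 χ h2 h1
    set D := derOfAut 1 χ h2
    refine ⟨D, ?_⟩
    ext g x
    have hg : σ'.hom g * χ = χ * σ.hom g := by rw [h3 g]; group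
    have := congrArg TrivSqZeroExt.snd (DFunLike.congr_fun hg (inl ((ρ g).symm x)))
    rw [← hχ, ← σ.liftAut_cocycle g, ← σ'.liftAut_cocycle g] at this
    simp [AlgEquiv.mul_apply] at this
    change ρ g (D ((ρ g).symm x)) - D x = σ.cocycle g x - σ'.cocycle g x
    linear_combination this
  · rintro ⟨D, hD⟩
    refine ⟨liftAut 1 D, by ext <;> simp, fun x => by simp, fun g => ?_⟩
    rw [eq_mul_inv_iff_mul_eq, ← σ.liftAut_cocycle g, ← σ'.liftAut_cocycle g]
    ext w
    · simp [AlgEquiv.mul_apply]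
    · have := DFunLike.congr_fun (congrFun hD g) (ρ g w.fst)
      change ρ g (D ((ρ g).symm (ρ g w.fst))) - D (ρ g w.fst) =
        σ.cocycle g (ρ g w.fst) - σ'.cocycle g (ρ g w.fst) at this
      rw [AlgEquiv.symm_apply_apply] at this
      simp [AlgEquiv.mul_apply]
      linear_combination this

/-- The standard bijection `D_ρ(k[ε]) ≃ H¹(G, Der_k B)`. -/
noncomputable def tangentEquiv (ρ : G →* (B ≃ₐ[k] B)) : Deformation ρ ≃ H1 (Der ρ) :=
  Equiv.ofBijective
    (Quotient.lift (s := Lift.setoid ρ) (fun σ => H1π (Der ρ) σ.cocycle)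
      fun σ σ' h => (Lift.equiv_iff σ σ').1 h)
    ⟨by
      rintro ⟨σ⟩ ⟨σ'⟩ h
      exact Quotient.sound ((Lift.equiv_iff σ σ').2 h), fun c => by
      induction c using H1_induction_on with | @h d =>
      exact ⟨Quotient.mk (Lift.setoid ρ) (liftOfCocycle d), by
        change H1π (Der ρ) (liftOfCocycle d).cocycle = _
        rw [cocycle_liftOfCocycle]⟩⟩

end Tangent

section Induction

open TrivSqZeroExt

variable {k G : Type*} [Field k] [Group G] {ρ : G →* (k⟦X⟧ ≃ₐ[k] k⟦X⟧)}

/-- The norm `∏_{s ∈ N} σ(s)(t)` of `t = X` for a lift `σ` of `ρ` to `k[ε]`. -/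
noncomputable def normLift (σ : Lift ρ) (N : Subgroup G) : k⟦X⟧[ε] :=
  ∏ᶠ s : N, σ.hom s (inl PowerSeries.X)

theorem eps_mem (σ : Lift ρ) (N : Subgroup G) : (ε : k⟦X⟧[ε]) ∈ fixed σ.hom N := fun s _ => σ.map_eps s

variable [Finite G] (σ : Lift ρ) (N : Subgroup G)

theorem fst_normLift : (normLift σ N).fst = normX ρ N := by
  classical
  have := Fintype.ofFinite N
  rw [normLift, normX, finprod_eq_prod_of_fintype, finprod_eq_prod_of_fintype]
  change fstHom k⟦X⟧ k⟦X⟧ k⟦X⟧ _ = _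
  rw [map_prod]
  exact Finset.prod_congr rfl fun s _ => by simp [σ.fst_hom]

theorem normLift_mem : normLift σ N ∈ fixed σ.hom N := by
  classical
  have := Fintype.ofFinite N
  intro s hs
  rw [normLift, finprod_eq_prod_of_fintype, map_prod]
  refine Fintype.prod_equiv (Equiv.mulLeft (⟨s, hs⟩ : N)) _ _ fun x => ?_
  rw [← AlgEquiv.mul_apply, ← map_mul]
  rfl

/-- The homomorphism `k⟦X⟧ → k⟦X⟧[ε]`, `f ↦ f(y + ε c) = f(y) + ε f'(y) c`, where `y + ε c` is the
norm `∏_{s ∈ N} σ(s)(t)`. -/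
noncomputable def substNormLift : k⟦X⟧ →ₐ[k] k⟦X⟧[ε] where
  toFun f := inl (substNormX ρ N f) +
    inr (substNormX ρ N (PowerSeries.derivative k f) * (normLift σ N).snd)
  map_one' := TrivSqZeroExt.ext (by simp) (by simp)
  map_mul' f g := TrivSqZeroExt.ext (by simp) (by simp; ring)
  map_zero' := TrivSqZeroExt.ext (by simp) (by simp)
  map_add' f g := TrivSqZeroExt.ext (by simp) (by simp; ring)
  commutes' a := TrivSqZeroExt.ext
    (by simpa [TrivSqZeroExt.algebraMap_eq_inl'] using (substNormX ρ N).commutes a)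
    (by simp [TrivSqZeroExt.algebraMap_eq_inl'])

theorem substNormLift_X : substNormLift σ N PowerSeries.X = normLift σ N :=
  TrivSqZeroExt.ext (by simp [substNormLift, fst_normLift]) (by simp [substNormLift])

theorem eq_zero_of_pow_dvd' {y c : k⟦X⟧[ε]} (hy : PowerSeries.X ∣ y.fst) (hy0 : y.fst ≠ 0)
    (h : ∀ m : ℕ, y ^ m ∣ c) : c = 0 := by
  have h1 : c.fst = 0 := eq_zero_of_pow_dvd hy fun m => by
    simpa using map_dvd (fstHom k⟦X⟧ k⟦X⟧ k⟦X⟧) (h m)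
  have h2 : c.snd = 0 := eq_zero_of_pow_dvd hy fun m => by
    obtain ⟨w, rfl⟩ := h m
    rw [fst_mul, fst_pow] at h1
    have h3 : w.fst = 0 := (mul_eq_zero.1 h1).resolve_left (pow_ne_zero _ hy0)
    exact ⟨w.snd, by simp [h3]⟩
  exact TrivSqZeroExt.ext h1 h2

/-- A homomorphism `k⟦X⟧ → k⟦X⟧[ε]` mapping `X` to the norm of `t` is determined by this. -/
theorem substNormLift_unique (ψ : k⟦X⟧ →ₐ[k] k⟦X⟧[ε]) (h : ψ PowerSeries.X = normLift σ N) :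
    ψ = substNormLift σ N :=
  psHom_ext (h.trans (substNormLift_X σ N).symm) fun c hc => by
    rw [h] at hc
    refine eq_zero_of_pow_dvd' ?_ ?_ hc
    · rw [fst_normLift]; exact X_dvd_normX ρ N
    · rw [fst_normLift]; exact normX_ne_zero ρ N

theorem substNormLift_mem (f : k⟦X⟧) : substNormLift σ N f ∈ fixed σ.hom N := fun s hs =>
  DFunLike.congr_fun (substNormLift_unique σ N ((σ.hom s).toAlgHom.comp (substNormLift σ N)) (by
    change σ.hom s (substNormLift σ N PowerSeries.X) = _
    rw [substNormLift_X, normLift_mem σ N s hs])) f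

variable (hρ : Function.Injective ρ)

/-- The `k[ε]`-linear homomorphism `k⟦t⟧^N[ε] → k⟦t⟧[ε]` that maps `f(y)` to `f(y + ε c)`. -/
noncomputable def trivHom : (fixed ρ N)[ε] →ₐ[k] k⟦X⟧[ε] :=
  DualNumber.lift ⟨((substNormLift σ N).comp (fixedEquiv ρ N hρ).symm.toAlgHom, ε),
    DualNumber.eps_mul_eps, fun _ => mul_comm _ _⟩

theorem trivHom_apply (w : (fixed ρ N)[ε]) : trivHom σ N hρ w =
    substNormLift σ N ((fixedEquiv ρ N hρ).symm w.fst) +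
      substNormLift σ N ((fixedEquiv ρ N hρ).symm w.snd) * ε := rfl

theorem fst_substNormLift_symm (x : fixed ρ N) :
    (substNormLift σ N ((fixedEquiv ρ N hρ).symm x)).fst = x := by
  have : substNormX ρ N ((fixedEquiv ρ N hρ).symm x) = fixedEquiv ρ N hρ ((fixedEquiv ρ N hρ).symm x) :=
    rfl
  simp [substNormLift, this]

theorem fst_trivHom (w : (fixed ρ N)[ε]) : (trivHom σ N hρ w).fst = w.fst := by
  simp [trivHom_apply, fst_substNormLift_symm]

theorem trivHom_mem (w : (fixed ρ N)[ε]) : trivHom σ N hρ w ∈ fixed σ.hom N :=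
  add_mem (substNormLift_mem σ N _) (mul_mem (substNormLift_mem σ N _) (eps_mem σ N))

/-- The isomorphism of `k[ε]`-algebras `k⟦t⟧^N[ε] ≃ k⟦t⟧[ε]^N` that maps `y = ∏_{s ∈ N} ρ(s)(t)`
to `∏_{s ∈ N} σ(s)(t)`. -/
noncomputable def trivEquiv : (fixed ρ N)[ε] ≃ₐ[k] fixed σ.hom N :=
  AlgEquiv.ofBijective ((trivHom σ N hρ).codRestrict (fixed σ.hom N) (trivHom_mem σ N hρ)) <| by
    constructor
    · rw [injective_iff_map_eq_zero]
      intro w hw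
      have h0 : trivHom σ N hρ w = 0 := congrArg Subtype.val hw
      have h1 : w.fst = 0 := by
        have := fst_trivHom σ N hρ w
        rw [h0] at this
        exact Subtype.ext this.symm
      have h2 : w.snd = 0 := by
        have := congrArg TrivSqZeroExt.snd h0
        rw [trivHom_apply, h1] at this
        simp [fst_substNormLift_symm] at this
        exact this
      exact TrivSqZeroExt.ext h1 h2
    · rintro ⟨v, hv⟩
      have h1 : v.fst ∈ fixed ρ N := fun s hs => by
        rw [← σ.fst_hom, hv s hs]
      have h2 : v - trivHom σ N hρ (inl ⟨v.fst, h1⟩) ∈ fixed σ.hom N :=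
        sub_mem hv (trivHom_mem σ N hρ _)
      set u := v - trivHom σ N hρ (inl ⟨v.fst, h1⟩) with hu
      have h3 : u.fst = 0 := by simp [hu, fst_trivHom]
      have h4 : u.snd ∈ fixed ρ N := fun s hs => by
        have h5 := congrArg TrivSqZeroExt.snd (h2 s hs)
        have h6 := snd_apply_of_fix (σ.hom s).toAlgHom (σ.map_eps s) u
        change (σ.hom s u).snd = (σ.hom s _).snd + (σ.hom s _).fst at h6
        rw [h6, h3, σ.fst_hom] at h5
        simpa using h5
      refine ⟨inl ⟨v.fst, h1⟩ + inr ⟨u.snd, h4⟩, Subtype.ext ?_⟩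
      change trivHom σ N hρ _ = v
      rw [map_add, add_comm, ← eq_sub_iff_add_eq, ← hu, trivHom_apply]
      exact TrivSqZeroExt.ext (by simp [h3]) (by simp [fst_substNormLift_symm])

@[simp] theorem coe_trivEquiv (w : (fixed ρ N)[ε]) :
    (trivEquiv σ N hρ w : k⟦X⟧[ε]) = trivHom σ N hρ w := rfl

theorem trivEquiv_eps : (trivEquiv σ N hρ ε : k⟦X⟧[ε]) = ε := by
  rw [coe_trivEquiv, trivHom_apply]
  simp

theorem trivEquiv_normX :
    (trivEquiv σ N hρ (inl ⟨normX ρ N, normX_mem ρ N⟩) : k⟦X⟧[ε]) = normLift σ N := by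
  have : (fixedEquiv ρ N hρ).symm ⟨normX ρ N, normX_mem ρ N⟩ = PowerSeries.X := by
    rw [AlgEquiv.symm_apply_eq]
    exact Subtype.ext (substNormX_X ρ N).symm
  rw [coe_trivEquiv, trivHom_apply]
  simp [this, substNormLift_X]

variable [N.Normal]

/-- The lift of the action `ρ^♯` of `G / N` on `k⟦t⟧^N` induced by a lift `σ` of `ρ`: the action of
`G / N` on the fixed ring `k⟦t⟧[ε]^N`, transported by `trivEquiv`. -/
noncomputable def Lift.induced : Lift (quotientAction ρ N) where
  hom :=
    { toFun := fun c =>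
        ((trivEquiv σ N hρ).trans (quotientAction σ.hom N c)).trans (trivEquiv σ N hρ).symm
      map_one' := by ext w <;> simp
      map_mul' := fun c d => by ext w <;> simp [AlgEquiv.mul_apply] }
  map_eps c := by
    induction c using QuotientGroup.induction_on with | @H g =>
    change (trivEquiv σ N hρ).symm (quotientAction σ.hom N g (trivEquiv σ N hρ ε)) = ε
    rw [AlgEquiv.symm_apply_eq]
    exact Subtype.ext (by rw [coe_quotientAction, trivEquiv_eps, σ.map_eps])
  fst_hom c w := by
    induction c using QuotientGroup.induction_on with | @H g =>
    change ((trivEquiv σ N hρ).symm (quotientAction σ.hom N g (trivEquiv σ N hρ w))).fst = _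
    refine Subtype.ext ?_
    rw [← fst_trivHom σ N hρ, ← coe_trivEquiv, AlgEquiv.apply_symm_apply, coe_quotientAction,
      σ.fst_hom, coe_trivEquiv, fst_trivHom, coe_quotientAction]

theorem induced_spec (g : G) (w : (fixed ρ N)[ε]) :
    trivHom σ N hρ ((σ.induced N hρ).hom g w) = σ.hom g (trivHom σ N hρ w) :=
  congrArg Subtype.val ((trivEquiv σ N hρ).apply_symm_apply
    (quotientAction σ.hom N g (trivEquiv σ N hρ w)))

theorem induced_equiv {σ σ' : Lift ρ} (h : Lift.setoid ρ σ σ') :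
    Lift.setoid (quotientAction ρ N) (σ.induced N hρ) (σ'.induced N hρ) := by
  obtain ⟨χ, h1, h2, h3⟩ := h
  have hm : ∀ v, v ∈ fixed σ.hom N ↔ χ v ∈ fixed σ'.hom N := fun v =>
    forall₂_congr fun s _ => by
      rw [h3 s, AlgEquiv.mul_apply, AlgEquiv.mul_apply, AlgEquiv.aut_inv, AlgEquiv.symm_apply_apply,
        χ.injective.eq_iff]
  let χN : fixed σ.hom N ≃ₐ[k] fixed σ'.hom N :=
    AlgEquiv.ofBijective ((χ.toAlgHom.comp (fixed σ.hom N).val).codRestrict (fixed σ'.hom N)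
        fun x => (hm x).1 x.2)
      ⟨fun x y hxy => Subtype.ext (χ.injective (congrArg Subtype.val hxy)), fun y =>
        ⟨⟨χ.symm y, (hm _).2 (by rw [χ.apply_symm_apply]; exact y.2)⟩,
          Subtype.ext (χ.apply_symm_apply y)⟩⟩
  have hχN : ∀ x, (χN x : k⟦X⟧[ε]) = χ x := fun _ => rfl
  let χ' := ((trivEquiv σ N hρ).trans χN).trans (trivEquiv σ' N hρ).symm
  have hχ' : ∀ w, trivHom σ' N hρ (χ' w) = χ (trivHom σ N hρ w) := fun w =>
    congrArg Subtype.val ((trivEquiv σ' N hρ).apply_symm_apply (χN (trivEquiv σ N hρ w)))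
  have hinj : Function.Injective (trivHom σ' N hρ) := fun a b hab =>
    (trivEquiv σ' N hρ).injective (Subtype.ext hab)
  refine ⟨χ', hinj ?_, fun w => Subtype.ext ?_, fun c => ?_⟩
  · rw [hχ', ← coe_trivEquiv, ← coe_trivEquiv, trivEquiv_eps, trivEquiv_eps, h1]
  · rw [← fst_trivHom σ' N hρ, hχ', h2, fst_trivHom]
  · induction c using QuotientGroup.induction_on with | @H g =>
    rw [eq_mul_inv_iff_mul_eq]
    refine AlgEquiv.ext fun w => hinj ?_
    rw [AlgEquiv.mul_apply, AlgEquiv.mul_apply, hχ', induced_spec, induced_spec, hχ', h3,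
      AlgEquiv.mul_apply, AlgEquiv.mul_apply, AlgEquiv.aut_inv, AlgEquiv.symm_apply_apply]

/-- The induction map `D_ρ(k[ε]) → D_{ρ^♯}(k[ε])`. -/
noncomputable def Deformation.ind : Deformation ρ → Deformation (quotientAction ρ N) :=
  Quotient.map' (s₁ := Lift.setoid ρ) (s₂ := Lift.setoid (quotientAction ρ N))
    (fun σ => σ.induced N hρ) fun _ _ h => induced_equiv N hρ h

end Induction

section Cohomology

open groupCohomology CategoryTheory

variable {k G : Type u} [CommRing k] [Group G] (A : Rep k G) (N : Subgroup G) [N.Normal]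

/-- The inflation map `Hⁿ(G/N, A^N) → Hⁿ(G, A)`. -/
noncomputable def inflation (n : ℕ) :
    groupCohomology (A.quotientToInvariants N) n →ₗ[k] groupCohomology A n :=
  (groupCohomology.map (QuotientGroup.mk' N) (Rep.ofHom (A.ρ.quotientToInvariants_lift N)) n).hom

/-- The action of `g ∈ G` on `H¹(N, A)`, induced by the map sending a cocycle `d` to
`s ↦ g • d (g⁻¹ s g)`. -/
noncomputable def conjH1 (g : G) : H1 (Rep.res N.subtype A) ⟶ H1 (Rep.res N.subtype A) :=
  groupCohomology.map (MulAut.conjNormal g⁻¹ : N ≃* N).toMonoidHom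
    (show Rep.res (MulAut.conjNormal g⁻¹ : N ≃* N).toMonoidHom (Rep.res N.subtype A) ⟶
        Rep.res N.subtype A from
      Rep.ofHom ⟨A.ρ g, fun s => by
        ext x
        change A.ρ g (A.ρ (MulAut.conjNormal g⁻¹ s : N) x) = A.ρ s (A.ρ g x)
        rw [MulAut.conjNormal_apply, ← Module.End.mul_apply, ← map_mul, ← Module.End.mul_apply,
          ← map_mul]
        congr 2
        group⟩) 1

/-- The invariants `H¹(N, A)^{G/N}` (the subgroup `N` acts trivially on `H¹(N, A)`). -/
noncomputable def invH1 : Submodule k (H1 (Rep.res N.subtype A)) :=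
  ⨅ g : G, LinearMap.eqLocus (conjH1 A N g).hom LinearMap.id

theorem conj_mem' (g : G) (s : N) : g⁻¹ * s * g ∈ N :=
  Subgroup.Normal.conj_mem' ‹_› _ s.2 g

theorem mem_invH1_iff (d : cocycles₁ (Rep.res N.subtype A)) :
    H1π (Rep.res N.subtype A) d ∈ invH1 A N ↔
      ∀ g : G, ∃ m : A, ∀ s : N,
        A.ρ g (d ⟨g⁻¹ * s * g, conj_mem' N g s⟩) - d s = A.ρ s m - m := by
  rw [invH1, Submodule.mem_iInf]
  refine forall_congr' fun g => ?_
  rw [LinearMap.mem_eqLocus, LinearMap.id_apply]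
  change conjH1 A N g (H1π _ d) = _ ↔ _
  rw [conjH1, H1π_comp_map_apply, H1π_eq_iff]
  have hs : ∀ s : N, (MulAut.conjNormal g⁻¹ s : N) = ⟨g⁻¹ * s * g, conj_mem' N g s⟩ := fun s =>
    Subtype.ext (by rw [MulAut.conjNormal_apply]; simp)
  constructor
  · rintro ⟨m, hm⟩
    refine ⟨m, fun s => ?_⟩
    rw [← hs]
    exact (congrFun hm s).symm
  · rintro ⟨m, hm⟩
    refine ⟨m, funext fun s => ?_⟩
    have := hm s
    rw [← hs] at this
    exact this.symm

/-- The restriction map `H¹(G, A) → H¹(N, A)^{G/N}`. -/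
noncomputable def resInv : H1 A →ₗ[k] invH1 A N :=
  LinearMap.codRestrict (invH1 A N) (groupCohomology.map N.subtype (𝟙 (Rep.res N.subtype A)) 1).hom
    fun κ => by
      induction κ using H1_induction_on with | @h d =>
      change groupCohomology.map N.subtype (𝟙 (Rep.res N.subtype A)) 1 (H1π A d) ∈ _
      rw [H1π_comp_map_apply, mem_invH1_iff]
      intro g
      refine ⟨d g, fun s => ?_⟩
      change A.ρ g (d (g⁻¹ * s * g)) - d s = A.ρ s (d g) - d g
      have h1 := (mem_cocycles₁_iff d).1 d.2 g (g⁻¹ * s * g)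
      have h2 := (mem_cocycles₁_iff d).1 d.2 s g
      rw [show g * (g⁻¹ * s * g) = s * g by group, h2] at h1
      rw [sub_eq_sub_iff_add_eq_add, ← h1]

/-- Triples `(d, b, c)` of a 1-cocycle `d : N → A`, a 1-cochain `b : G → A` that extends `d`, and a
2-cocycle `c` of `G/N` in `A^N` whose inflation to `G` is the coboundary of `b`. -/
def transgressionData : Submodule k (cocycles₁ (Rep.res N.subtype A) × (G → A) ×
    cocycles₂ (A.quotientToInvariants N)) where
  carrier := {x | (∀ s : N, x.2.1 s = x.1 s) ∧ ∀ g h : G,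
    ((x.2.2 ((g : G ⧸ N), (h : G ⧸ N))).1 : A) =
      A.ρ g (x.2.1 h) - x.2.1 (g * h) + x.2.1 g}
  add_mem' := by
    rintro ⟨d, b, c⟩ ⟨d', b', c'⟩ ⟨h1, h2⟩ ⟨h1', h2'⟩
    refine ⟨fun s => ?_, fun g h => ?_⟩
    · change b s + b' s = d s + d' s
      rw [← h1, ← h1']
    · change (c _).1 + (c' _).1 = A.ρ g (b h + b' h) - (b (g * h) + b' (g * h)) + (b g + b' g)
      rw [h2, h2', map_add]
      abel
  zero_mem' := by
    refine ⟨fun s => rfl, fun g h => ?_⟩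
    change (0 : A) = A.ρ g 0 - 0 + 0
    simp
  smul_mem' := by
    rintro r ⟨d, b, c⟩ ⟨h1, h2⟩
    refine ⟨fun s => ?_, fun g h => ?_⟩
    · change r • b s = r • d s
      rw [← h1]
    · change r • (c _).1 = A.ρ g (r • b h) - r • b (g * h) + r • b g
      rw [h2, map_smul, smul_add, smul_sub]

theorem extends_mul {A : Rep k G} {N : Subgroup G} [N.Normal] {x} (hx : x ∈ transgressionData A N)
    (g : G) (s : N) : x.2.1 (g * s) = x.2.1 g + A.ρ g (x.1 s) ∧
      x.2.1 (s * g) = x.1 s + A.ρ s (x.2.1 g) := by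
  obtain ⟨d, b, c⟩ := x
  obtain ⟨h1, h2⟩ := hx
  change (∀ s : N, b s = d s) at h1
  change ∀ g h : G, (c ((g : G ⧸ N), (h : G ⧸ N))).1 = A.ρ g (b h) - b (g * h) + b g at h2
  change b (g * s) = b g + A.ρ g (d s) ∧ b (s * g) = d s + A.ρ s (b g)
  have hs : ((s : G) : G ⧸ N) = 1 := (QuotientGroup.eq_one_iff _).2 s.2
  have hb1 : b 1 = 0 := by
    have := h1 1
    rw [cocycles₁_map_one] at this
    exact this
  have h0 : c ((1 : G ⧸ N), (1 : G ⧸ N)) = 0 := by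
    refine Subtype.ext ?_
    have := h2 1 1
    rw [mul_one, hb1] at this
    simpa using this
  constructor
  · have h3 := h2 g s
    rw [hs, cocycles₂_map_one_snd, h0, h1] at h3
    simp only [map_zero, ZeroMemClass.coe_zero] at h3
    rw [eq_comm, ← sub_eq_zero, h3]
    abel
  · have h3 := h2 s g
    rw [hs, cocycles₂_map_one_fst, h0, h1] at h3
    simp only [ZeroMemClass.coe_zero] at h3
    rw [eq_comm, ← sub_eq_zero, h3]
    abel

/-- The map `(d, b, c) ↦ [d]`. -/
noncomputable def transgressionSource : transgressionData A N →ₗ[k] invH1 A N :=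
  LinearMap.codRestrict (invH1 A N) ((H1π (Rep.res N.subtype A)).hom ∘ₗ LinearMap.fst k _ _ ∘ₗ
    (transgressionData A N).subtype) fun x => by
      change H1π _ x.1.1 ∈ _
      rw [mem_invH1_iff]
      intro g
      refine ⟨x.1.2.1 g, fun s => ?_⟩
      have h1 := (extends_mul x.2 g ⟨g⁻¹ * s * g, conj_mem' N g s⟩).1
      have h2 := (extends_mul x.2 g s).2
      change x.1.2.1 (g * (g⁻¹ * s * g)) = _ at h1
      rw [show g * (g⁻¹ * s * g) = s * g by group, h2] at h1
      rw [sub_eq_sub_iff_add_eq_add, add_comm, ← h1]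
      abel

/-- The map `(d, b, c) ↦ [c]`. -/
noncomputable def transgressionTarget :
    transgressionData A N →ₗ[k] H2 (A.quotientToInvariants N) :=
  (H2π (A.quotientToInvariants N)).hom ∘ₗ LinearMap.snd k _ _ ∘ₗ LinearMap.snd k _ _ ∘ₗ
    (transgressionData A N).subtype

theorem transgression_aux (x : transgressionData A N) (h : transgressionSource A N x = 0) :
    transgressionTarget A N x = 0 := by
  obtain ⟨⟨d, b, c⟩, hx⟩ := x
  have h0 : H1π (Rep.res N.subtype A) d = 0 := congrArg Subtype.val h
  obtain ⟨m, hm⟩ := (H1π_eq_zero_iff d).1 h0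
  have hm' : ∀ s : N, A.ρ s m - m = d s := fun s => congrFun hm s
  have hr : ∀ (g : G) (s : N), b (g * s) = b g + A.ρ g (d s) := fun g s => (extends_mul hx g s).1
  have hl : ∀ (g : G) (s : N), b (s * g) = d s + A.ρ s (b g) := fun g s => (extends_mul hx g s).2
  have hc : ∀ g h : G, (c ((g : G ⧸ N), (h : G ⧸ N))).1 = A.ρ g (b h) - b (g * h) + b g := hx.2
  let b₀ : G → A := fun g => b g - (A.ρ g m - m)
  have hr0 : ∀ (g : G) (s : N), b₀ (g * s) = b₀ g := fun g s => by
    simp only [b₀, hr, ← hm', map_mul, Module.End.mul_apply, map_sub]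
    abel
  have hl0 : ∀ (g : G) (s : N), A.ρ s (b₀ g) = b₀ g := fun g s => by
    have h1 : b₀ (s * g) = A.ρ s (b₀ g) := by
      simp only [b₀, hl, ← hm', map_mul, Module.End.mul_apply, map_sub]
      abel
    rw [← h1, show (s : G) * g = g * (⟨g⁻¹ * s * g, conj_mem' N g s⟩ : N) by
      change _ = g * (g⁻¹ * s * g); group, hr0]
  change H2π _ c = 0
  rw [H2π_eq_zero_iff]
  refine ⟨fun q => Quotient.liftOn' q (fun g => ⟨b₀ g, fun s => hl0 g s⟩) fun g h hgh => ?_, ?_⟩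
  · refine Subtype.ext ?_
    have := hr0 g ⟨g⁻¹ * h, QuotientGroup.leftRel_apply.1 hgh⟩
    change b₀ g = b₀ h
    rw [← this]
    congr 1
    exact mul_inv_cancel_left g h
  · funext ⟨q, r⟩
    induction q using QuotientGroup.induction_on with | @H g =>
    induction r using QuotientGroup.induction_on with | @H h =>
    refine Subtype.ext ?_
    rw [hc]
    change A.ρ g (b₀ h) - b₀ (g * h) + b₀ g = _
    simp only [b₀, map_mul, Module.End.mul_apply, map_sub]
    abel

theorem exists_extends (d : cocycles₁ (Rep.res N.subtype A))
    (hd0 : H1π (Rep.res N.subtype A) d ∈ invH1 A N) : ∃ b : G → A, (∀ s : N, b s = d s) ∧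
      (∀ (g : G) (s : N), b (g * s) = b g + A.ρ g (d s)) ∧
      ∀ (g : G) (s : N), b (s * g) = d s + A.ρ s (b g) := by
  classical
  have hd : ∀ s s' : N, d (s * s') = A.ρ s (d s') + d s := (mem_cocycles₁_iff d).1 d.2
  have hex : ∀ g : G, ∃ m : A, (∀ hg : g ∈ N, m = d ⟨g, hg⟩) ∧ ∀ s : N,
      A.ρ g (d ⟨g⁻¹ * s * g, conj_mem' N g s⟩) = d s + A.ρ s m - m := by
    intro g
    by_cases hg : g ∈ N
    · refine ⟨d ⟨g, hg⟩, fun _ => rfl, fun s => ?_⟩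
      have h1 := hd ⟨g, hg⟩ ⟨g⁻¹ * s * g, conj_mem' N g s⟩
      have h2 := hd s ⟨g, hg⟩
      rw [show (⟨g, hg⟩ : N) * ⟨g⁻¹ * s * g, conj_mem' N g s⟩ = s * ⟨g, hg⟩ from
        Subtype.ext (by change g * (g⁻¹ * s * g) = s * g; group), h2] at h1
      rw [eq_sub_iff_add_eq, ← h1, add_comm]
    · obtain ⟨m, hm⟩ := (mem_invH1_iff A N d).1 hd0 g
      exact ⟨m, fun h => absurd h hg, fun s => by
        rw [add_sub_assoc, ← hm s]; abel⟩
  choose m hmN hm using hex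
  let r : G → G := fun g => (Quotient.out (g : G ⧸ N))
  have hrs : ∀ (g : G) (s : N), r (g * s) = r g := fun g s => by
    simp only [r]
    rw [QuotientGroup.mk_mul_of_mem g s.2]
  have hr : ∀ g, ∃ s : N, g = r g * s := fun g =>
    ⟨⟨(r g)⁻¹ * g, QuotientGroup.eq.1 (Quotient.out_eq _)⟩, (mul_inv_cancel_left _ _).symm⟩
  choose q hq using hr
  let b : G → A := fun g => m (r g) + A.ρ (r g) (d (q g))
  have hbr : ∀ (g : G) (s : N), b (g * s) = b g + A.ρ g (d s) := fun g s => by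
    have h1 : q (g * s) = q g * s := by
      refine Subtype.ext (mul_left_cancel (a := r g) ?_)
      rw [← hrs g s, ← hq, hrs, Subgroup.coe_mul, ← mul_assoc, ← hq]
    have h2 : A.ρ g (d s) = A.ρ (r g) (A.ρ (q g) (d s)) := by
      rw [← Module.End.mul_apply, ← map_mul, ← hq]
    simp only [b]
    rw [h1, hd, hrs, map_add, h2]
    abel
  have hbN : ∀ s : N, b s = d s := fun s => by
    have h1 : r s ∈ N := by
      have h3 := N.mul_mem s.2 (N.inv_mem (q s).2)
      have h4 : r s = s * (q s : G)⁻¹ := by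
        rw [eq_mul_inv_iff_mul_eq]; exact (hq s).symm
      rwa [h4]
    have h2 := hd ⟨r s, h1⟩ (q s)
    rw [show (⟨r s, h1⟩ : N) * q s = s from Subtype.ext (hq s).symm] at h2
    simp only [b]
    rw [hmN _ h1, h2, add_comm]
  have hbm : ∀ (g : G) (s : N), A.ρ g (d ⟨g⁻¹ * s * g, conj_mem' N g s⟩) =
      d s + A.ρ s (b g) - b g := fun g s => by
    set s' : N := ⟨(r g)⁻¹ * s * r g, conj_mem' N _ s⟩ with hs'
    have h1 := hd (q g) ⟨g⁻¹ * s * g, conj_mem' N g s⟩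
    have h2 : q g * ⟨g⁻¹ * s * g, conj_mem' N g s⟩ = s' * q g := by
      refine Subtype.ext ?_
      change (q g : G) * (g⁻¹ * s * g) = (r g)⁻¹ * s * r g * q g
      have h3 : (q g : G) = (r g)⁻¹ * g := by rw [eq_inv_mul_iff_mul_eq]; exact (hq g).symm
      rw [h3]; group
    rw [h2, hd] at h1
    have h4 : A.ρ g (d ⟨g⁻¹ * s * g, conj_mem' N g s⟩) =
        A.ρ (r g) (A.ρ (q g) (d ⟨g⁻¹ * s * g, conj_mem' N g s⟩)) := by
      rw [← Module.End.mul_apply, ← map_mul, ← hq]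
    have h5 : A.ρ (r g) (A.ρ s' (d (q g))) = A.ρ s (A.ρ (r g) (d (q g))) := by
      rw [← Module.End.mul_apply, ← map_mul, ← Module.End.mul_apply, ← map_mul]
      congr 2
      simp only [hs']
      group
    rw [h4, eq_sub_of_add_eq h1.symm, map_sub, map_add, h5, hm (r g) s]
    simp only [b, map_add]
    abel
  refine ⟨b, hbN, hbr, fun g s => ?_⟩
  rw [show (s : G) * g = g * (⟨g⁻¹ * s * g, conj_mem' N g s⟩ : N) by
    change _ = g * (g⁻¹ * s * g); group, hbr, hbm]
  abel

theorem transgressionSource_surjective : Function.Surjective (transgressionSource A N) := by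
  rintro ⟨κ, hκ⟩
  induction κ using H1_induction_on with | @h d =>
  obtain ⟨b, hbN, hbr, hbl⟩ := exists_extends A N d hκ
  let c : G → G → A := fun g h => A.ρ g (b h) - b (g * h) + b g
  have hc1 : ∀ (g h : G) (s : N), c g (h * s) = c g h := fun g h s => by
    simp only [c]
    rw [← mul_assoc, hbr, hbr, map_add, map_mul, Module.End.mul_apply]
    abel
  have hc2 : ∀ (g h : G) (s : N), c (s * g) h = A.ρ s (c g h) := fun g h s => by
    simp only [c]
    rw [mul_assoc, hbl, hbl, map_mul, Module.End.mul_apply, map_add, map_sub]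
    abel
  have hc3 : ∀ (g h : G) (s : N), c (g * s) h = c g h := fun g h s => by
    have h1 : c (g * s) h = c g (s * h) := by
      simp only [c]
      rw [mul_assoc, hbl, hbr, map_mul, Module.End.mul_apply, map_add]
      abel
    rw [h1, show (s : G) * h = h * (⟨h⁻¹ * s * h, conj_mem' N h s⟩ : N) by
      change _ = h * (h⁻¹ * s * h); group, hc1]
  have hc4 : ∀ (g h : G) (s : N), A.ρ s (c g h) = c g h := fun g h s => by
    rw [← hc2, show (s : G) * g = g * (⟨g⁻¹ * s * g, conj_mem' N g s⟩ : N) by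
      change _ = g * (g⁻¹ * s * g); group, hc3]
  let c' : (G ⧸ N) × (G ⧸ N) → A.quotientToInvariants N := fun q =>
    Quotient.liftOn₂' q.1 q.2 (fun g h => ⟨c g h, fun s => hc4 g h s⟩) fun g h g' h' hg hh => by
      refine Subtype.ext ?_
      change c g h = c g' h'
      rw [← hc3 g h ⟨g⁻¹ * g', QuotientGroup.leftRel_apply.1 hg⟩,
        ← hc1 _ h ⟨h⁻¹ * h', QuotientGroup.leftRel_apply.1 hh⟩]
      simp
  have hc' : c' ∈ cocycles₂ (A.quotientToInvariants N) := by
    rw [mem_cocycles₂_iff]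
    intro q₁ q₂ q₃
    induction q₁ using QuotientGroup.induction_on with | @H g =>
    induction q₂ using QuotientGroup.induction_on with | @H h =>
    induction q₃ using QuotientGroup.induction_on with | @H j =>
    refine Subtype.ext ?_
    change c (g * h) j + c g h = A.ρ g (c h j) + c g (h * j)
    simp only [c, map_mul, Module.End.mul_apply, map_add, map_sub, mul_assoc]
    abel
  exact ⟨⟨⟨d, b, ⟨c', hc'⟩⟩, hbN, fun g h => rfl⟩, rfl⟩

/-- The linear map induced by `g` on the image of a surjective linear map `f`. -/
noncomputable def descend {M P Q : Type*} [AddCommGroup M] [AddCommGroup P] [AddCommGroup Q]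
    [Module k M] [Module k P] [Module k Q] (f : M →ₗ[k] P) (g : M →ₗ[k] Q)
    (hf : Function.Surjective f) (h : ∀ x, f x = 0 → g x = 0) : P →ₗ[k] Q :=
  (LinearMap.ker f).liftQ g (fun x hx => LinearMap.mem_ker.2 (h x (LinearMap.mem_ker.1 hx))) ∘ₗ (f.quotKerEquivOfSurjective hf).symm.toLinearMap

theorem descend_apply {M P Q : Type*} [AddCommGroup M] [AddCommGroup P] [AddCommGroup Q]
    [Module k M] [Module k P] [Module k Q] (f : M →ₗ[k] P) (g : M →ₗ[k] Q)
    (hf : Function.Surjective f) (h : ∀ x, f x = 0 → g x = 0) (x : M) :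
    descend f g hf h (f x) = g x := by
  have : (f.quotKerEquivOfSurjective hf).symm (f x) = Submodule.Quotient.mk x := by
    rw [LinearEquiv.symm_apply_eq]
    rfl
  rw [descend, LinearMap.comp_apply, LinearEquiv.coe_coe, this, Submodule.liftQ_apply]

/-- The transgression `H¹(N, A)^{G/N} → H²(G/N, A^N)`: it maps `[d]` to `[c]` whenever a cochain
`b : G → A` extends `d` and the coboundary of `b` is the inflation of `c`. -/
noncomputable def transgression : invH1 A N →ₗ[k] H2 (A.quotientToInvariants N) :=
  descend (M := transgressionData A N) (P := invH1 A N) (Q := H2 (A.quotientToInvariants N))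
    (transgressionSource A N) (transgressionTarget A N)
    (transgressionSource_surjective A N) (transgression_aux A N)

theorem transgression_apply (x : transgressionData A N) :
    transgression A N (transgressionSource A N x) = transgressionTarget A N x :=
  descend_apply _ _ _ _ x

end Cohomology

section Sharp

open CategoryTheory

variable {k G B : Type u} [Field k] [Group G] [CommRing B] [Algebra k B]
  (ρ : G →* (B ≃ₐ[k] B)) (N : Subgroup G)

theorem apply_mem_fixed_of_mem_invariants {d : Derivation k B B}
    (hd : d ∈ Representation.invariants ((derRep ρ).comp N.subtype)) (x : fixed ρ N) :
    d x ∈ fixed ρ N := fun s hs => by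
  have h1 : derRep ρ s d = d := hd ⟨s, hs⟩
  have h2 := DFunLike.congr_fun h1 x.1
  rwa [derRep_apply, (AlgEquiv.symm_apply_eq _).2 (x.2 s hs).symm] at h2

variable [N.Normal]

/-- `(Der_k B)^N` as a `G/N`-module. -/
noncomputable abbrev DerInv : Rep k (G ⧸ N) := (Der ρ).quotientToInvariants N

/-- `Der^♯ = Der_k (B^N)` as a `G/N`-module. -/
abbrev DerSharp : Rep k (G ⧸ N) := Der (quotientAction ρ N)

/-- The restriction `d ↦ d|_{B^N}` as a map `(Der_k B)^N → Der_k (B^N)` of `G/N`-modules. -/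
noncomputable def restrictDer : DerInv ρ N ⟶ DerSharp ρ N :=
  Rep.ofHom
    ⟨{ toFun := fun d => Derivation.mk'
          { toFun := fun x : fixed ρ N =>
              (⟨d.1 x, apply_mem_fixed_of_mem_invariants ρ N d.2 x⟩ : fixed ρ N)
            map_add' := fun x y => Subtype.ext (map_add d.1 (x : B) y)
            map_smul' := fun c x =>
              Subtype.ext ((d.1 : Derivation k B B).map_smul c (x : B)) }
          fun x y => Subtype.ext ((d.1 : Derivation k B B).leibniz (x : B) y)
       map_add' := fun _ _ => rfl
       map_smul' := fun _ _ => rfl }, fun c => by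
      induction c using QuotientGroup.induction_on with | @H g =>
      ext d x
      change ρ g (d.1 ((ρ g).symm x)) = ρ g (d.1 (ρ g⁻¹ x))
      rw [map_inv]
      rfl⟩

@[simp] theorem coe_restrictDer (d : DerInv ρ N) (x : fixed ρ N) :
    (((restrictDer ρ N).hom d : Derivation k (fixed ρ N) (fixed ρ N)) x : B) =
      (d.1 : Derivation k B B) x := rfl

/-- The image of `Der^N` in `Der^♯`. -/
noncomputable abbrev rangeRestrict : Submodule k (DerSharp ρ N) :=
  LinearMap.range (restrictDer ρ N).hom.toLinearMap

theorem rangeRestrict_le (c : G ⧸ N) :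
    rangeRestrict ρ N ≤ (rangeRestrict ρ N).comap ((DerSharp ρ N).ρ c) := by
  rintro _ ⟨d, rfl⟩
  exact ⟨(DerInv ρ N).ρ c d, Rep.hom_comm_apply (restrictDer ρ N) c d⟩

/-- The `G/N`-module `Der^♯/Der^N`. -/
noncomputable abbrev DerQuot : Rep k (G ⧸ N) :=
  (DerSharp ρ N).quotient (rangeRestrict ρ N) (rangeRestrict_le ρ N)

/-- The projection `Der^♯ → Der^♯/Der^N`. -/
noncomputable abbrev toDerQuot : DerSharp ρ N ⟶ DerQuot ρ N :=
  (DerSharp ρ N).mkQ (rangeRestrict ρ N) (rangeRestrict_le ρ N)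

/-- The sequence `Der^N → Der^♯ → Der^♯/Der^N` of `G/N`-modules. -/
@[simps]
noncomputable def derSeq : ShortComplex (Rep k (G ⧸ N)) where
  X₁ := DerInv ρ N
  X₂ := DerSharp ρ N
  X₃ := DerQuot ρ N
  f := restrictDer ρ N
  g := toDerQuot ρ N
  zero := by
    ext d
    exact (Submodule.Quotient.mk_eq_zero _).2 ⟨d, rfl⟩

/-- The `k`-module `Der_1 = Der_k(B^N, B)`. -/
abbrev DerOne : Type u := Derivation k (fixed ρ N) B

theorem apply_algebraMap_fixed (g : G) (x : fixed ρ N) :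
    ρ g (algebraMap (fixed ρ N) B x) = algebraMap (fixed ρ N) B (quotientAction ρ N g x) := rfl

/-- The action of `G` on `Der_1 = Der_k(B^N, B)`: `α^g = ρ(g) ∘ α ∘ ρ^♯(g)⁻¹`. -/
def derOneRep : Representation k G (DerOne ρ N) where
  toFun g := conjDer (quotientAction ρ N (g : G ⧸ N)) (ρ g) (apply_algebraMap_fixed ρ N g)
  map_one' := by
    ext α x
    rw [conjDer_apply, QuotientGroup.mk_one, map_one, map_one]
    rfl
  map_mul' g h := by
    ext α x
    rw [conjDer_apply, QuotientGroup.mk_mul, map_mul, map_mul]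
    rfl

/-- The restriction map `Der = Der_k B → Der_1`. -/
def derToDerOne (d : Derivation k B B) : DerOne ρ N := d.compAlgebraMap (fixed ρ N)

/-- The inclusion map `Der^♯ = Der_k (B^N) → Der_1`. -/
def derSharpToDerOne (e : Derivation k (fixed ρ N) (fixed ρ N)) : DerOne ρ N :=
  (Algebra.linearMap (fixed ρ N) B).compDer e

end Sharp

section LocalActions

open CategoryTheory groupCohomology PowerSeries

variable {k G : Type u} [Field k] [Group G] [Finite G] (ρ : G →* (k⟦X⟧ ≃ₐ[k] k⟦X⟧))
  (N : Subgroup G)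

theorem derivation_ext {d d' : Derivation k k⟦X⟧ k⟦X⟧} (h : d X = d' X) : d = d' := by
  ext1 f
  refine sub_eq_zero.1 (eq_zero_of_pow_dvd (dvd_refl X) fun m => ?_)
  obtain ⟨q, hq⟩ : (X : k⟦X⟧) ^ (m + 1) ∣ f - (trunc (m + 1) f : k⟦X⟧) := by
    rw [X_pow_dvd_iff]
    intro i hi
    simp [coeff_trunc, hi]
  have hf : f = (trunc (m + 1) f : k⟦X⟧) + X ^ (m + 1) * q := by rw [← hq]; ring
  have hpol : ∀ p : Polynomial k, d (p : k⟦X⟧) = d' (p : k⟦X⟧) := fun p => by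
    induction p using Polynomial.induction_on' with
    | add p q hp hq => simp [hp, hq]
    | monomial n a =>
      have hX : ((Polynomial.monomial n a : Polynomial k) : k⟦X⟧) = a • X ^ n := by
        rw [Polynomial.coe_monomial, X_pow_eq, ← LinearMap.map_smul, smul_eq_mul, mul_one]
      rw [hX, d.map_smul, d'.map_smul, Derivation.leibniz_pow, Derivation.leibniz_pow, h]
  rw [hf, map_add, map_add, hpol]
  simp only [Derivation.leibniz, Derivation.leibniz_pow, smul_eq_mul, h, Nat.add_sub_cancel]
  refine ⟨X * d q - X * d' q, ?_⟩
  ring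

theorem derivation_eval {R : Type*} [CommRing R] [Algebra k R] (d : Derivation k R R)
    (P : Polynomial R) (hP : ∀ i, d (P.coeff i) = 0) (x : R) :
    d (P.eval x) = P.derivative.eval x * d x := by
  rw [Polynomial.derivative_eval, Polynomial.eval_eq_sum, Polynomial.sum, Polynomial.sum, map_sum,
    Finset.sum_mul]
  refine Finset.sum_congr rfl fun i _ => ?_
  rw [Derivation.leibniz, hP, Derivation.leibniz_pow]
  simp only [smul_eq_mul, nsmul_eq_mul, mul_zero, add_zero]
  ring

theorem restrictDer_injective (hρ : Function.Injective ρ) [N.Normal] :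
    Function.Injective (restrictDer ρ N).hom := by
  classical
  rw [injective_iff_map_eq_zero]
  intro d hd
  have hd0 : ∀ x ∈ fixed ρ N, (d.1 : Derivation k k⟦X⟧ k⟦X⟧) x = 0 := fun x hx =>
    congrArg (fun e : Derivation k (fixed ρ N) (fixed ρ N) => (e ⟨x, hx⟩ : k⟦X⟧)) hd
  have := Fintype.ofFinite N
  let P : Polynomial k⟦X⟧ := ∏ s : N, (Polynomial.X - Polynomial.C (ρ s X))
  have hP : ∀ i, P.coeff i ∈ fixed ρ N := fun i s hs => by
    have h : P.map (ρ s : k⟦X⟧ →+* k⟦X⟧) = P := by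
      rw [Polynomial.map_prod]
      refine Fintype.prod_equiv (Equiv.mulLeft (⟨s, hs⟩ : N)) _ _ fun x => ?_
      simp [← AlgEquiv.mul_apply]
    conv_rhs => rw [← h]
    rw [Polynomial.coeff_map]
    rfl
  let P₂ : Polynomial k⟦X⟧ := ∏ s ∈ Finset.univ.erase (1 : N), (Polynomial.X - Polynomial.C (ρ s X))
  have hP₂ : P = (Polynomial.X - Polynomial.C X) * P₂ := by
    have := Finset.mul_prod_erase Finset.univ
      (fun s : N => (Polynomial.X - Polynomial.C (ρ s X) : Polynomial k⟦X⟧)) (Finset.mem_univ 1)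
    simp only [Subgroup.coe_one, map_one, AlgEquiv.one_apply] at this
    exact this.symm
  have h0 : P.derivative.eval X ≠ 0 := by
    rw [hP₂, Polynomial.derivative_mul]
    simp only [Polynomial.derivative_sub, Polynomial.derivative_X, Polynomial.derivative_C,
      sub_zero, one_mul, Polynomial.eval_add, Polynomial.eval_mul, Polynomial.eval_sub,
      Polynomial.eval_X, Polynomial.eval_C, sub_self, zero_mul, add_zero, P₂,
      Polynomial.eval_prod]
    refine Finset.prod_ne_zero_iff.2 fun s hs h => Finset.ne_of_mem_erase hs (Subtype.ext ?_)
    refine apply_X_injective ρ hρ ?_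
    change ρ s X = ρ 1 X
    rw [map_one]
    exact (sub_eq_zero.1 h).symm
  have h1 := derivation_eval (d.1 : Derivation k k⟦X⟧ k⟦X⟧) P (fun i => hd0 _ (hP i)) X
  rw [show P.eval X = 0 by rw [hP₂]; simp, map_zero] at h1
  refine Subtype.ext (derivation_ext ?_)
  exact (mul_eq_zero.1 h1.symm).resolve_left h0

theorem derSeq_shortExact (hρ : Function.Injective ρ) [N.Normal] : (derSeq ρ N).ShortExact where
  exact := by
    rw [← ShortComplex.exact_map_iff_of_faithful _ (forget₂ (Rep k (G ⧸ N)) (ModuleCat k)),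
      ShortComplex.moduleCat_exact_iff_range_eq_ker]
    exact (Submodule.ker_mkQ _).symm
  mono_f := (Rep.mono_iff_injective _).2 (restrictDer_injective ρ N hρ)
  epi_g := (Rep.epi_iff_surjective _).2 (Submodule.mkQ_surjective _)

/-- The map `ind : H¹(G, Der) → H¹(G/N, Der^♯)` of tangent spaces. -/
noncomputable def indH1 (hρ : Function.Injective ρ) [N.Normal] (κ : H1 (Der ρ)) : H1 (DerSharp ρ N) :=
  tangentEquiv (quotientAction ρ N) (Deformation.ind N hρ ((tangentEquiv ρ).symm κ))

end LocalActions

section Diagram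

open CategoryTheory groupCohomology

variable {k G : Type u} [Field k] [Group G]

/-- The map `H¹(G/N, Der^N) → H¹(G/N, Der^♯)` induced by the restriction `Der^N → Der^♯`. -/
noncomputable def mapH1Sharp {B : Type u} [CommRing B] [Algebra k B] (ρ : G →* (B ≃ₐ[k] B))
    (N : Subgroup G) [N.Normal] : H1 (DerInv ρ N) →ₗ[k] H1 (DerSharp ρ N) :=
  (groupCohomology.map (MonoidHom.id (G ⧸ N)) (restrictDer ρ N) 1).hom

/-- The map `H¹(G/N, Der^♯) → H¹(G/N, Der^♯/Der^N)` induced by the projection. -/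
noncomputable def sigmaH1 {B : Type u} [CommRing B] [Algebra k B] (ρ : G →* (B ≃ₐ[k] B))
    (N : Subgroup G) [N.Normal] : H1 (DerSharp ρ N) →ₗ[k] H1 (DerQuot ρ N) :=
  (groupCohomology.map (MonoidHom.id (G ⧸ N)) (toDerQuot ρ N) 1).hom

/-- The connecting map `H¹(G/N, Der^♯/Der^N) → H²(G/N, Der^N)` of the exact sequence
`0 → Der^N → Der^♯ → Der^♯/Der^N → 0`. -/
noncomputable def boundaryH1 [Finite G] (ρ : G →* (k⟦X⟧ ≃ₐ[k] k⟦X⟧)) (hρ : Function.Injective ρ)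
    (N : Subgroup G) [N.Normal] : H1 (DerQuot ρ N) →ₗ[k] H2 (DerInv ρ N) :=
  (groupCohomology.δ (derSeq_shortExact ρ N hρ) 1 2 rfl).hom

end Diagram

end LocalAction

/-! Everything is compared inside `Der_1`, where three facts hold. The image of `Der^♯` is exactly
the group of `N`-invariants (`exists_derSharpToDerOne_eq`). The map from `Der` is injective
(`derToDerOne_injective`), so `Der` and `Der^♯` meet exactly in `Der^N` (`toDerQuot_eq_zero`). Every
cocycle `N → Der` becomes a coboundary in `Der_1` (`exists_cobounding`): it defines a lift of the
action of `N` to `k[ε]`, the norm of `t` under this lift is invariant, and minus its `ε`-part, taken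
as the value at `y`, defines the required `α`.

Let `d_s = α^s - α` on `N`, and let `b` extend `d` compatibly with translations by `N`. Then `α^g -
α - b_g` is `N`-invariant, hence equal to some `a_g` in `Der^♯`. Since `g ↦ α^g - α` is a
coboundary, the coboundaries of `a` and `b` are opposite, so the coboundary of `a` lies in `Der ∩
Der^♯ = Der^N`. Hence `ā` is a cocycle and `[d] ↦ -[ā]` can be defined. Moreover `-a` lifts the
cocycle `-ā` and has the same coboundary as `b`, which is the equality of `tg` with the connecting
map after `γ` (`δ_gamma`).

For `ind`, the trivialization `f(y) ↦ f(y + ε c)` of the deformed fixed ring has an `ε`-part `α` in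
`Der_1`, and transport of structure gives `e_g = α^g - α + d_g` for the induced cocycle `e`
(`isInduced_induced`). This relation alone determines `[e]` from `[d]`, whatever `α` is
(`IsInduced.H1π_eq`). It is stable under linear combinations, so `ind` is linear; with `α = 0` it
gives the left square; read as a decomposition of the coboundary of `-α`, it gives the middle one.

The lower row is part of a long exact cohomology sequence. In the upper row, the terms around the
transgression are checked on cochains. -/

namespace LocalAction

/-! ### The five-term sequence of inflation, restriction and transgression. -/

section FiveTerm

open groupCohomology CategoryTheory

variable {k G : Type u} [CommRing k] [Group G]

theorem H1π_eq_iff_exists {A : Rep k G} (x y : cocycles₁ A) :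
    H1π A x = H1π A y ↔ ∃ m : A, ∀ g : G, A.ρ g m - m = x g - y g := by
  rw [H1π_eq_iff]
  exact ⟨fun ⟨m, hm⟩ => ⟨m, fun g => congrFun hm g⟩, fun ⟨m, hm⟩ => ⟨m, funext hm⟩⟩

theorem H1π_eq_zero_iff_exists {A : Rep k G} (x : cocycles₁ A) :
    H1π A x = 0 ↔ ∃ m : A, ∀ g : G, A.ρ g m - m = x g := by
  rw [H1π_eq_zero_iff]
  exact ⟨fun ⟨m, hm⟩ => ⟨m, fun g => congrFun hm g⟩, fun ⟨m, hm⟩ => ⟨m, funext hm⟩⟩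

theorem H2π_eq_zero_iff_exists {A : Rep k G} (x : cocycles₂ A) :
    H2π A x = 0 ↔ ∃ b : G → A, ∀ g h : G, A.ρ g (b h) - b (g * h) + b g = x (g, h) := by
  rw [H2π_eq_zero_iff]
  exact ⟨fun ⟨b, hb⟩ => ⟨b, fun g h => congrFun hb (g, h)⟩,
    fun ⟨b, hb⟩ => ⟨b, funext fun q => hb q.1 q.2⟩⟩

variable (A : Rep k G) (N : Subgroup G) [N.Normal]

/-- This and the next two lemmas supply explicit representing cocycles, so that later arguments can
be made on cochains. -/
theorem inflation_H1π (c : cocycles₁ (A.quotientToInvariants N)) :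
    ∃ d : cocycles₁ A, (∀ g : G, d g = (c (g : G ⧸ N)).1) ∧
      inflation A N 1 (H1π _ c) = H1π A d := by
  refine ⟨⟨fun g => (c (g : G ⧸ N)).1, (mem_cocycles₁_iff _).2 fun g h =>
    congrArg Subtype.val ((mem_cocycles₁_iff _).1 c.2 g h)⟩, fun _ => rfl, ?_⟩
  rw [inflation]
  erw [H1π_comp_map_apply (QuotientGroup.mk' N)]
  rfl

theorem inflation_H2π (c : cocycles₂ (A.quotientToInvariants N)) :
    ∃ d : cocycles₂ A, (∀ g h : G, d (g, h) = (c ((g : G ⧸ N), (h : G ⧸ N))).1) ∧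
      inflation A N 2 (H2π _ c) = H2π A d := by
  refine ⟨⟨fun g => (c ((g.1 : G ⧸ N), (g.2 : G ⧸ N))).1, (mem_cocycles₂_iff _).2 fun g h j =>
    congrArg Subtype.val ((mem_cocycles₂_iff _).1 c.2 g h j)⟩, fun _ _ => rfl, ?_⟩
  rw [inflation]
  erw [H2π_comp_map_apply (QuotientGroup.mk' N)]
  rfl

theorem resInv_H1π (d : cocycles₁ A) :
    ∃ d' : cocycles₁ (Rep.res N.subtype A), (∀ s : N, d' s = d s) ∧
      (resInv A N (H1π A d)).1 = H1π _ d' :=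
  ⟨mapCocycles₁ N.subtype (𝟙 (Rep.res N.subtype A)) d, fun _ => rfl, H1π_comp_map_apply _ _ _⟩

theorem inflation_injective : Function.Injective (inflation A N 1) :=
  (ModuleCat.mono_iff_injective (H1InfRes A N).f).1 inferInstance

theorem exact_inflation_resInv : Function.Exact (inflation A N 1) (resInv A N) := by
  intro κ
  rw [← Submodule.coe_eq_zero]
  exact (ShortComplex.ShortExact.moduleCat_exact_iff_function_exact (H1InfRes A N)).1
    (H1InfRes_exact A N) κ

variable {A N}

theorem transgression_eq {d : cocycles₁ (Rep.res N.subtype A)} {b : G → A}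
    {c : cocycles₂ (A.quotientToInvariants N)} (hd : H1π (Rep.res N.subtype A) d ∈ invH1 A N)
    (hb : ∀ s : N, b s = d s)
    (hc : ∀ g h : G, (c ((g : G ⧸ N), (h : G ⧸ N))).1 = A.ρ g (b h) - b (g * h) + b g) :
    transgression A N ⟨H1π _ d, hd⟩ = H2π _ c :=
  transgression_apply A N ⟨(d, b, c), hb, hc⟩

theorem exists_transgression_eq (x : invH1 A N) :
    ∃ (d : cocycles₁ (Rep.res N.subtype A)) (b : G → A) (c : cocycles₂ (A.quotientToInvariants N)),
      (∀ s : N, b s = d s) ∧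
      (∀ g h : G, (c ((g : G ⧸ N), (h : G ⧸ N))).1 = A.ρ g (b h) - b (g * h) + b g) ∧
      x.1 = H1π _ d ∧ transgression A N x = H2π _ c := by
  obtain ⟨⟨⟨d, b, c⟩, hb, hc⟩, rfl⟩ := transgressionSource_surjective A N x
  exact ⟨d, b, c, hb, hc, rfl, transgression_apply A N _⟩

variable (A N)

/-- If `c` is the coboundary of a cochain `e` on `G/N`, then `b` minus the inflation of `e` is a
cocycle on `G` that still restricts to `d`. Conversely, a cocycle on all of `G` serves as its own
`b`, with `c = 0`. -/
theorem exact_resInv_transgression : Function.Exact (resInv A N) (transgression A N) := by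
  intro x
  constructor
  · intro hx
    obtain ⟨d, b, c, hb, hc, hxd, htr⟩ := exists_transgression_eq x
    rw [htr, H2π_eq_zero_iff_exists] at hx
    obtain ⟨e, he⟩ := hx
    have he' : ∀ g h : G, A.ρ g (e h).1 - (e ((g * h : G) : G ⧸ N)).1 + (e g).1 =
        A.ρ g (b h) - b (g * h) + b g := fun g h =>
      (congrArg Subtype.val (he g h)).trans (hc g h)
    have hb1 : b 1 = 0 := by
      have := hb 1
      rw [cocycles₁_map_one] at this
      exact this
    -- The correction `e` must vanish on `N` in order not to change the restriction of `b`; the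
    -- cochain identity at `(1, 1)` forces this.
    have he1 : (e ((1 : G) : G ⧸ N)).1 = 0 := by
      have := he' 1 1
      rw [hb1, mul_one, hb1] at this
      simpa using this
    let f : cocycles₁ A := ⟨fun g => b g - (e g).1, (mem_cocycles₁_iff _).2 fun g h => by
      rw [map_sub, ← sub_eq_zero]
      have := sub_eq_zero.2 (he' g h)
      rw [← this]
      abel⟩
    obtain ⟨d', hd', hr⟩ := resInv_H1π A N f
    refine ⟨H1π A f, Subtype.ext ?_⟩
    rw [hr, hxd]
    congr 1
    refine Subtype.ext (funext fun s => ?_)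
    refine (hd' s).trans ?_
    have hs : ((s : G) : G ⧸ N) = ((1 : G) : G ⧸ N) := (QuotientGroup.eq_one_iff _).2 s.2
    change b s - (e ((s : G) : G ⧸ N)).1 = d s
    rw [hs, he1, hb, sub_zero]
  · rintro ⟨κ, rfl⟩
    induction κ using H1_induction_on with | @h d =>
    obtain ⟨d', hd', hr⟩ := resInv_H1π A N d
    have h := transgression_eq (c := 0) (b := d) (hr ▸ (resInv A N (H1π A d)).2)
      (fun s => (hd' s).symm) fun g h => by
        rw [(mem_cocycles₁_iff d).1 d.2 g h]
        change (0 : A) = _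
        abel
    rw [map_zero] at h
    rw [← h]
    congr 1
    exact Subtype.ext hr

/-- A cochain `b` on `G` that bounds the inflation of `c` restricts to a cocycle on `N` as soon as
`c` is normalized, and then `b` exhibits `c` as a transgression. -/
theorem exact_transgression_inflation :
    Function.Exact (transgression A N) (inflation A N 2) := by
  intro x
  constructor
  · intro hx
    induction x using H2_induction_on with | @h c =>
    obtain ⟨c', hc', hi⟩ := inflation_H2π A N c
    rw [hi, H2π_eq_zero_iff_exists] at hx
    obtain ⟨b, hb⟩ := hx
    -- The coboundary of the constant cochain `v` is `(g, h) ↦ g • v`, with value `v` at `(1, 1)`.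
    -- Subtracting it from `c`, and `v` from `b`, normalizes `c` without changing its class.
    set v := c (1, 1) with hv
    let c₀ : cocycles₂ (A.quotientToInvariants N) :=
      ⟨d₁₂ (A.quotientToInvariants N) fun _ => v, d₁₂_apply_mem_cocycles₂ _⟩
    have hc₀ : ∀ g h : G, (c₀ ((g : G ⧸ N), (h : G ⧸ N))).1 = A.ρ g v.1 - v.1 + v.1 :=
      fun g h => rfl
    have hH : H2π _ (c - c₀) = H2π _ c := by
      rw [map_sub, sub_eq_self]
      exact (H2π_eq_zero_iff c₀).2 ⟨fun _ => v, rfl⟩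
    have hb' : ∀ g h : G, ((c - c₀) ((g : G ⧸ N), (h : G ⧸ N))).1 =
        A.ρ g (b h - v.1) - (b (g * h) - v.1) + (b g - v.1) := fun g h => by
      change (c _).1 - (c₀ _).1 = _
      rw [hc₀, ← hc', ← hb, map_sub]
      abel
    have hN : ∀ s : N, ((s : G) : G ⧸ N) = 1 := fun s => (QuotientGroup.eq_one_iff _).2 s.2
    let d : cocycles₁ (Rep.res N.subtype A) :=
      ⟨fun s => b s - v.1, (mem_cocycles₁_iff _).2 fun s s' => by
        have h1 := hb' s s'
        have h2 : ((c - c₀) (((s : G) : G ⧸ N), ((s' : G) : G ⧸ N))).1 = 0 := by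
          change (c _).1 - (c₀ _).1 = _
          have h3 : A.ρ s v.1 = v.1 := v.2 s
          rw [hc₀, hN, hN, ← hv, h3]
          abel
        rw [h2] at h1
        change b (s * s') - v.1 = A.ρ s (b s' - v.1) + (b s - v.1)
        rw [← sub_eq_zero, ← neg_eq_zero, h1]
        abel⟩
    refine ⟨transgressionSource A N ⟨(d, fun g => b g - v.1, c - c₀), fun s => rfl, hb'⟩, ?_⟩
    rw [transgression_apply]
    exact hH
  · rintro ⟨x, rfl⟩
    obtain ⟨d, b, c, hb, hc, -, htr⟩ := exists_transgression_eq x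
    obtain ⟨c', hc', hi⟩ := inflation_H2π A N c
    rw [htr, hi, H2π_eq_zero_iff_exists]
    exact ⟨b, fun g h => by rw [hc', hc]⟩

end FiveTerm

/-! ### The images of `Der` and `Der^♯` in `Der_1`. -/

section DerOne

variable {k G B : Type u} [Field k] [Group G] [CommRing B] [Algebra k B]
  {ρ : G →* (B ≃ₐ[k] B)} {N : Subgroup G}

theorem derSharpToDerOne_injective : Function.Injective (derSharpToDerOne ρ N) := fun _ _ h =>
  Derivation.ext fun x => Subtype.ext (DFunLike.congr_fun h x)

variable [N.Normal]

theorem derOneRep_derToDerOne (g : G) (d : Derivation k B B) :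
    derOneRep ρ N g (derToDerOne ρ N d) = derToDerOne ρ N (derRep ρ g d) := by
  ext x
  change ρ g (d (ρ g⁻¹ x)) = ρ g (d ((ρ g).symm x))
  rw [map_inv]
  rfl

theorem derToDerOne_eq_restrictDer (d : DerInv ρ N) :
    derToDerOne ρ N d.1 = derSharpToDerOne ρ N ((restrictDer ρ N).hom d) := rfl

/-- Since `N` acts trivially on `B^N`, invariance of `α` means that its values are `N`-invariant. -/
theorem exists_derSharpToDerOne_eq {α : DerOne ρ N} (h : ∀ s : N, derOneRep ρ N s α = α) :
    ∃ e : DerSharp ρ N, derSharpToDerOne ρ N e = α := by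
  have hα : ∀ x, α x ∈ fixed ρ N := fun x s hs => by
    have h1 := DFunLike.congr_fun (h ⟨s, hs⟩) x
    have h2 : (quotientAction ρ N (s : G ⧸ N)).symm x = x := by
      rw [(QuotientGroup.eq_one_iff s).2 hs, map_one]
      rfl
    change ρ s (α ((quotientAction ρ N (s : G ⧸ N)).symm x)) = α x at h1
    rwa [h2] at h1
  exact ⟨Derivation.mk'
    { toFun := fun x => (⟨α x, hα x⟩ : fixed ρ N)
      map_add' := fun x y => Subtype.ext (map_add α x y)
      map_smul' := fun c x => Subtype.ext (α.map_smul c x) }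
    fun x y => Subtype.ext (α.leibniz x y), rfl⟩

end DerOne

/-! ### `Der_1` for power series: injectivity, the coordinate `α(y)`, and vanishing of cocycles. -/

section PowerSeries

open TrivSqZeroExt

variable {k G : Type u} [Field k] [Group G] [Finite G] {ρ : G →* (k⟦X⟧ ≃ₐ[k] k⟦X⟧)}
  {N : Subgroup G}

/-- Reduction to the `N`-invariant case, `restrictDer_injective`. If `d` kills `k⟦t⟧^N`, then so
does the trace over `N` of `f • d`, which is invariant and therefore zero. Thus `∑ ρ(s)(f) d^s(x) =
0` for all `f`, and Dedekind's independence of characters gives `d^s(x) = 0` for every `s`, in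
particular for `s = 1`. -/
theorem derToDerOne_injective (hρ : Function.Injective ρ) [N.Normal] :
    Function.Injective (derToDerOne ρ N) := by
  classical
  have := Fintype.ofFinite N
  intro d₁ d₂ h
  rw [← sub_eq_zero]
  set d := d₁ - d₂
  have hd : ∀ x ∈ fixed ρ N, d x = 0 := fun x hx => sub_eq_zero.2 (DFunLike.congr_fun h ⟨x, hx⟩)
  have hT : ∀ f x : k⟦X⟧, ∑ s : N, ρ s f * derRep ρ s d x = 0 := fun f x => by
    let D : Derivation k k⟦X⟧ k⟦X⟧ := ∑ s : N, derRep ρ s (f • d)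
    have hD : D ∈ Representation.invariants ((derRep ρ).comp N.subtype) := fun s => by
      change derRep ρ s D = D
      rw [map_sum]
      refine Fintype.sum_equiv (Equiv.mulLeft s) _ _ fun u => ?_
      rw [← Module.End.mul_apply, ← map_mul]
      rfl
    have hDx : ∀ x, D x = ∑ s : N, ρ s f * derRep ρ s d x := fun x => by
      change Derivation.coeFnAddMonoidHom (∑ s : N, derRep ρ s (f • d)) x = _
      rw [map_sum, Finset.sum_apply]
      refine Finset.sum_congr rfl fun s _ => ?_
      change derRep ρ s (f • d) x = _
      simp
    have h0 : (⟨D, hD⟩ : DerInv ρ N) = 0 := restrictDer_injective ρ N hρ (by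
      rw [map_zero]
      refine Derivation.ext fun x => Subtype.ext ?_
      change D x = 0
      rw [hDx]
      refine Finset.sum_eq_zero fun s _ => ?_
      rw [derRep_apply, (AlgEquiv.symm_apply_eq _).2 (x.2 s s.2).symm, hd x x.2, map_zero, mul_zero])
    rw [← hDx, show D = 0 from congrArg Subtype.val h0]
    rfl
  have hi : Function.Injective fun s : N => ((ρ s : k⟦X⟧ →* k⟦X⟧)) := fun s t hst =>
    Subtype.ext (hρ (AlgEquiv.ext fun x => DFunLike.congr_fun hst x))
  have hli := Fintype.linearIndependent_iff.1
    ((linearIndependent_monoidHom k⟦X⟧ k⟦X⟧).comp _ hi)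
  refine Derivation.ext fun x => ?_
  have := hli (fun s => derRep ρ s d x) (funext fun f => by
    rw [Finset.sum_apply]
    refine Eq.trans (Finset.sum_congr rfl fun s _ => ?_) (hT f x)
    exact mul_comm _ _) 1
  rw [Subgroup.coe_one, map_one] at this
  exact this

/-- A derivation `α` amounts to the algebra homomorphism `f ↦ f(y) + ε α(f(y))`. Such a homomorphism
is determined by the image of the variable, because no nonzero element is divisible by all powers of
that image. -/
theorem derOne_ext (hρ : Function.Injective ρ) {α β : DerOne ρ N}
    (h : α ⟨normX ρ N, normX_mem ρ N⟩ = β ⟨normX ρ N, normX_mem ρ N⟩) : α = β := by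
  let ψ : DerOne ρ N → (k⟦X⟧ →ₐ[k] k⟦X⟧[ε]) := fun α =>
    { toFun := fun f => inl (substNormX ρ N f) + inr (α (fixedEquiv ρ N hρ f))
      map_one' := TrivSqZeroExt.ext (by simp) (by simp)
      map_mul' := fun f g => TrivSqZeroExt.ext (by simp) (by
        have hc : ∀ f, ((fixedEquiv ρ N hρ f : fixed ρ N) : k⟦X⟧) = substNormX ρ N f := fun _ => rfl
        simp [Subalgebra.smul_def, hc]
        ring)
      map_zero' := TrivSqZeroExt.ext (by simp) (by simp)
      map_add' := fun f g => TrivSqZeroExt.ext (by simp) (by simp)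
      commutes' := fun a => TrivSqZeroExt.ext
        (by simpa [TrivSqZeroExt.algebraMap_eq_inl'] using (substNormX ρ N).commutes a)
        (by
          change (0 : k⟦X⟧) + α (fixedEquiv ρ N hρ (algebraMap k k⟦X⟧ a)) = 0
          rw [AlgEquiv.commutes, Derivation.map_algebraMap, add_zero]) }
  have hX : fixedEquiv ρ N hρ PowerSeries.X = ⟨normX ρ N, normX_mem ρ N⟩ :=
    Subtype.ext (substNormX_X ρ N)
  have hψX : ∀ α, ψ α PowerSeries.X = inl (normX ρ N) + inr (α ⟨normX ρ N, normX_mem ρ N⟩) :=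
    fun α => by
      change inl (substNormX ρ N PowerSeries.X) + inr (α (fixedEquiv ρ N hρ PowerSeries.X)) = _
      rw [hX, substNormX_X]
  have hψ : ψ α = ψ β := by
    refine psHom_ext (by rw [hψX, hψX, h]) fun c hc => eq_zero_of_pow_dvd' ?_ ?_ hc
    · simpa [hψX] using X_dvd_normX ρ N
    · simpa [hψX] using normX_ne_zero ρ N
  refine Derivation.ext fun x => ?_
  have := congrArg TrivSqZeroExt.snd (DFunLike.congr_fun hψ ((fixedEquiv ρ N hρ).symm x))
  simpa [ψ] using this

/-- The derivation is `f(y) ↦ f'(y) c`. -/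
theorem exists_derOne (hρ : Function.Injective ρ) (c : k⟦X⟧) :
    ∃ α : DerOne ρ N, α ⟨normX ρ N, normX_mem ρ N⟩ = c := by
  have hX : (fixedEquiv ρ N hρ).symm ⟨normX ρ N, normX_mem ρ N⟩ = PowerSeries.X := by
    rw [AlgEquiv.symm_apply_eq]
    exact Subtype.ext (substNormX_X ρ N).symm
  have hc : ∀ x, substNormX ρ N ((fixedEquiv ρ N hρ).symm x) = x := fun x =>
    congrArg Subtype.val ((fixedEquiv ρ N hρ).apply_symm_apply x)
  refine ⟨Derivation.mk'
    { toFun := fun x => substNormX ρ N (PowerSeries.derivative k ((fixedEquiv ρ N hρ).symm x)) * c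
      map_add' := fun x y => by simp [add_mul]
      map_smul' := fun a x => by simp }
    fun x y => ?_, ?_⟩
  · simp [Algebra.smul_def, hc]
    ring
  · simp [hX]

variable (ρ N) in
-- An additive Hilbert 90 obtained from a multiplicative norm. The norm `P = y + ε c` of `t` under
-- the lift of `ρ|_N` defined by `d` is fixed by that lift; the `ε`-part of this says `ρ(s)(c) +
-- d_s(y) = c`.
theorem exists_cobounding [N.Normal] (hρ : Function.Injective ρ)
    (d : groupCohomology.cocycles₁ (Rep.res N.subtype (Der ρ))) :
    ∃ α : DerOne ρ N, ∀ s : N, derToDerOne ρ N (d s) = derOneRep ρ N s α - α := by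
  classical
  have := Fintype.ofFinite N
  let σ : Lift (ρ.comp N.subtype) := liftOfCocycle (ρ := ρ.comp N.subtype) d
  let P := normLift σ ⊤
  have hP1 : P.fst = normX ρ N := by
    rw [fst_normLift, normX, normX]
    exact finprod_eq_of_bijective (fun s => s.1)
      ⟨Subtype.val_injective, fun s => ⟨⟨s, trivial⟩, rfl⟩⟩ fun _ => rfl
  -- The sign comes from `d_s(y) = c - ρ(s)(c)`. It suffices to compare both sides at `y`, by
  -- `derOne_ext`.
  obtain ⟨α, hα⟩ := exists_derOne (ρ := ρ) (N := N) hρ (-P.snd)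
  refine ⟨α, fun s => derOne_ext hρ ?_⟩
  have h1 : liftAut (ρ s) (d s) P = P := normLift_mem σ ⊤ s trivial
  have h2 := congrArg TrivSqZeroExt.snd h1
  rw [snd_liftAut, hP1, normX_mem ρ N s s.2] at h2
  have h3 : (quotientAction ρ N (s : G ⧸ N)).symm ⟨normX ρ N, normX_mem ρ N⟩ =
      ⟨normX ρ N, normX_mem ρ N⟩ := by
    rw [(QuotientGroup.eq_one_iff (s : G)).2 s.2, map_one]
    rfl
  change (d s : Derivation k k⟦X⟧ k⟦X⟧) (normX ρ N) = ρ s (α ((quotientAction ρ N (s : G ⧸ N)).symm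
    ⟨normX ρ N, normX_mem ρ N⟩)) - α ⟨normX ρ N, normX_mem ρ N⟩
  rw [h3, hα, map_neg]
  linear_combination h2

end PowerSeries

/-! ### Linear and equivariant forms of the two maps into `Der_1`. -/

section LinearMaps

variable {k G B : Type u} [Field k] [Group G] [CommRing B] [Algebra k B]
  (ρ : G →* (B ≃ₐ[k] B)) (N : Subgroup G) [N.Normal]

/-- The restriction map `Der → Der_1` as a linear map. -/
def derToDerOneₗ : Der ρ →ₗ[k] DerOne ρ N where
  toFun := derToDerOne ρ N
  map_add' _ _ := rfl
  map_smul' _ _ := rfl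

/-- The inclusion map `Der^♯ → Der_1` as a linear map. -/
def derSharpToDerOneₗ : DerSharp ρ N →ₗ[k] DerOne ρ N where
  toFun := derSharpToDerOne ρ N
  map_add' _ _ := rfl
  map_smul' _ _ := by
    ext
    rfl

variable {ρ N}

theorem derOneRep_derToDerOneₗ (g : G) (d : Der ρ) :
    derOneRep ρ N g (derToDerOneₗ ρ N d) = derToDerOneₗ ρ N ((Der ρ).ρ g d) :=
  derOneRep_derToDerOne g d

theorem derOneRep_derSharpToDerOneₗ (g : G) (e : DerSharp ρ N) :
    derOneRep ρ N g (derSharpToDerOneₗ ρ N e) =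
      derSharpToDerOneₗ ρ N ((DerSharp ρ N).ρ (g : G ⧸ N) e) := rfl

theorem derSharpToDerOneₗ_injective : Function.Injective (derSharpToDerOneₗ ρ N) :=
  derSharpToDerOne_injective

theorem derOneRep_mul (g h : G) (α : DerOne ρ N) :
    derOneRep ρ N (g * h) α = derOneRep ρ N g (derOneRep ρ N h α) := by
  rw [map_mul]
  rfl

end LinearMaps

/-! ### Decompositions `α^g - α = a_g + b_g` and the map `γ`. -/

section Gamma

open groupCohomology CategoryTheory

variable {k G B : Type u} [Field k] [Group G] [CommRing B] [Algebra k B]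
  {ρ : G →* (B ≃ₐ[k] B)} {N : Subgroup G} [N.Normal]

/-- This is `Der ∩ Der^♯ = Der^N` inside `Der_1`. The common image is `N`-invariant because it comes
from `Der^♯`; by injectivity `d` itself is invariant, and `e` is its restriction. -/
theorem toDerQuot_eq_zero (hι : Function.Injective (derToDerOne ρ N)) {e : DerSharp ρ N} {d : Der ρ}
    (h : derSharpToDerOneₗ ρ N e = derToDerOneₗ ρ N d) : (toDerQuot ρ N).hom e = 0 := by
  have hd : d ∈ Representation.invariants ((derRep ρ).comp N.subtype) := fun s => by
    refine hι ?_
    refine (derOneRep_derToDerOne (N := N) (s : G) d).symm.trans ?_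
    change derOneRep ρ N s (derToDerOneₗ ρ N d) = derToDerOneₗ ρ N d
    rw [← h, derOneRep_derSharpToDerOneₗ, (QuotientGroup.eq_one_iff (s : G)).2 s.2, map_one]
    rfl
  refine (Submodule.Quotient.mk_eq_zero _).2 ⟨⟨d, hd⟩, ?_⟩
  exact (derSharpToDerOne_injective (h.trans (derToDerOne_eq_restrictDer ⟨d, hd⟩))).symm

/-- The cochain `g ↦ α^g - α` satisfies the cocycle identity, so the defects of `a` and `b` cancel;
each lies in `Der ∩ Der^♯`. For `s` in `N` also `a_s = d_s - b_s` lies there, so `ā` vanishes on `N`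
and descends to `G/N`. Nothing is assumed of `b` beyond the decomposition. -/
theorem exists_cocycle_derQuot (hι : Function.Injective (derToDerOne ρ N)) {α : DerOne ρ N}
    {d : N → Der ρ} {a : G → DerSharp ρ N} {b : G → Der ρ}
    (hα : ∀ s : N, derToDerOneₗ ρ N (d s) = derOneRep ρ N s α - α)
    (hab : ∀ g : G, derOneRep ρ N g α - α =
      derSharpToDerOneₗ ρ N (a g) + derToDerOneₗ ρ N (b g)) :
    ∃ c : cocycles₁ (DerQuot ρ N), ∀ g : G, c (g : G ⧸ N) = (toDerQuot ρ N).hom (a g) := by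
  have hmul : ∀ g h : G, (toDerQuot ρ N).hom (a (g * h)) =
      (DerQuot ρ N).ρ (g : G ⧸ N) ((toDerQuot ρ N).hom (a h)) + (toDerQuot ρ N).hom (a g) :=
    fun g h => by
      have := toDerQuot_eq_zero hι
        (e := a (g * h) - ((DerSharp ρ N).ρ (g : G ⧸ N) (a h) + a g))
        (d := (Der ρ).ρ g (b h) + b g - b (g * h)) (by
          rw [map_sub, map_add, map_sub, map_add, ← derOneRep_derSharpToDerOneₗ,
            ← derOneRep_derToDerOneₗ]
          have h1 := hab (g * h)
          have h2 := congrArg (derOneRep ρ N g) (hab h)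
          have h3 := hab g
          rw [map_sub, map_add] at h2
          rw [derOneRep_mul] at h1
          rw [eq_sub_iff_add_eq.2 h1.symm, eq_sub_iff_add_eq.2 h2.symm,
            eq_sub_iff_add_eq.2 h3.symm]
          abel)
      rw [map_sub, sub_eq_zero, map_add] at this
      rw [this]
      congr 1
  have hN : ∀ s : N, (toDerQuot ρ N).hom (a s) = 0 := fun s =>
    toDerQuot_eq_zero hι (d := d s - b s) (by
      rw [map_sub, hα, hab]
      abel)
  refine ⟨⟨fun q => Quotient.liftOn' q (fun g => (toDerQuot ρ N).hom (a g)) fun g h hgh => ?_,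
    (mem_cocycles₁_iff _).2 fun q r => ?_⟩, fun g => rfl⟩
  · have h1 := hmul g (g⁻¹ * h)
    have h2 := hN ⟨g⁻¹ * h, QuotientGroup.leftRel_apply.1 hgh⟩
    rw [mul_inv_cancel_left, h2, map_zero, zero_add] at h1
    exact h1.symm
  · induction q using QuotientGroup.induction_on with | @H g =>
    induction r using QuotientGroup.induction_on with | @H h =>
    exact hmul g h

/-- The difference `β_g = α^g - α - b_g` satisfies `β_{gs} = β_g` and `β_{sg} = (β_g)^s`. As `sg =
gs'` with `s'` in `N`, it is `N`-invariant and comes from `Der^♯`. Here `a` itself, not only its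
class modulo `Der^N`, depends only on `gN`. -/
theorem exists_sharp {α : DerOne ρ N} {d : N → Der ρ} {b : G → Der ρ}
    (hα : ∀ s : N, derToDerOneₗ ρ N (d s) = derOneRep ρ N s α - α)
    (hr : ∀ (g : G) (s : N), b (g * s) = b g + (Der ρ).ρ g (d s))
    (hl : ∀ (g : G) (s : N), b (s * g) = d s + (Der ρ).ρ s (b g)) :
    ∃ a : G ⧸ N → DerSharp ρ N, ∀ g : G, derOneRep ρ N g α - α =
      derSharpToDerOneₗ ρ N (a g) + derToDerOneₗ ρ N (b g) := by
  let β : G → DerOne ρ N := fun g => derOneRep ρ N g α - α - derToDerOneₗ ρ N (b g)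
  have hβr : ∀ (g : G) (s : N), β (g * s) = β g := fun g s => by
    simp only [β]
    rw [hr, map_add, ← derOneRep_derToDerOneₗ, hα, map_sub, derOneRep_mul]
    abel
  have hβl : ∀ (g : G) (s : N), derOneRep ρ N s (β g) = β g := fun g s => by
    have h1 : β (s * g) = derOneRep ρ N s (β g) := by
      simp only [β]
      rw [hl, map_add, ← derOneRep_derToDerOneₗ, hα, map_sub, map_sub, derOneRep_mul]
      abel
    rw [← h1, show (s : G) * g = g * (⟨g⁻¹ * s * g, conj_mem' N g s⟩ : N) by
      change _ = g * (g⁻¹ * s * g); group, hβr]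
  choose a ha using fun g => exists_derSharpToDerOne_eq (hβl g)
  refine ⟨fun q => Quotient.liftOn' q a fun g h hgh => ?_, fun g => ?_⟩
  · refine derSharpToDerOne_injective ?_
    rw [ha, ha, ← hβr g ⟨g⁻¹ * h, QuotientGroup.leftRel_apply.1 hgh⟩, mul_inv_cancel_left]
  · exact eq_add_of_sub_eq (ha g).symm

theorem exists_sharp_of_mem_invH1 {α : DerOne ρ N}
    {d : cocycles₁ (Rep.res N.subtype (Der ρ))} (hd : H1π _ d ∈ invH1 (Der ρ) N)
    (hα : ∀ s : N, derToDerOneₗ ρ N (d s) = derOneRep ρ N s α - α) :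
    ∃ (a : G → DerSharp ρ N) (b : G → Der ρ), ∀ g : G, derOneRep ρ N g α - α =
      derSharpToDerOneₗ ρ N (a g) + derToDerOneₗ ρ N (b g) := by
  obtain ⟨b, -, hr, hl⟩ := exists_extends (Der ρ) N d hd
  obtain ⟨a, ha⟩ := exists_sharp hα hr hl
  exact ⟨fun g => a g, b, ha⟩

variable (ρ N)

/-- Triples `(d, α, c)` of a cocycle `d : N → Der` with `G/N`-invariant class, an element `α` of
`Der_1` with `d_s = α^s - α` for `s ∈ N`, and a cocycle `c` of `G/N` in `Der^♯/Der^N` that is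
represented by the first components of a decomposition `α^g - α = a_g + b_g`. -/
def gammaData : Submodule k (cocycles₁ (Rep.res N.subtype (Der ρ)) × DerOne ρ N ×
    cocycles₁ (DerQuot ρ N)) where
  carrier := {x | H1π _ x.1 ∈ invH1 (Der ρ) N ∧
    (∀ s : N, derToDerOneₗ ρ N (x.1 s) = derOneRep ρ N s x.2.1 - x.2.1) ∧
    ∃ (a : G → DerSharp ρ N) (b : G → Der ρ),
      (∀ g : G, derOneRep ρ N g x.2.1 - x.2.1 =
        derSharpToDerOneₗ ρ N (a g) + derToDerOneₗ ρ N (b g)) ∧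
      ∀ g : G, x.2.2 (g : G ⧸ N) = (toDerQuot ρ N).hom (a g)}
  add_mem' := by
    rintro ⟨d, α, c⟩ ⟨d', α', c'⟩ ⟨h1, h2, a, b, h3, h4⟩ ⟨h1', h2', a', b', h3', h4'⟩
    refine ⟨?_, fun s => ?_, a + a', b + b', fun g => ?_, fun g => ?_⟩
    · change H1π _ (d + d') ∈ _
      rw [map_add]
      exact add_mem h1 h1'
    · change derToDerOneₗ ρ N (d s + d' s) = derOneRep ρ N s (α + α') - (α + α')
      rw [map_add, h2, h2', map_add]
      abel
    · change derOneRep ρ N g (α + α') - (α + α') =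
        derSharpToDerOneₗ ρ N (a g + a' g) + derToDerOneₗ ρ N (b g + b' g)
      rw [map_add, map_add, map_add, add_add_add_comm, ← h3, ← h3']
      abel
    · change c g + c' g = (toDerQuot ρ N).hom (a g + a' g)
      rw [map_add, h4, h4']
  zero_mem' := by
    refine ⟨?_, fun s => ?_, 0, 0, fun g => ?_, fun g => ?_⟩
    · change H1π _ 0 ∈ _
      rw [map_zero]
      exact zero_mem _
    · change derToDerOneₗ ρ N 0 = derOneRep ρ N s 0 - 0
      simp
    · change derOneRep ρ N g 0 - 0 = derSharpToDerOneₗ ρ N 0 + derToDerOneₗ ρ N 0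
      simp
    · change 0 = (toDerQuot ρ N).hom 0
      rw [map_zero]
  smul_mem' := by
    rintro r ⟨d, α, c⟩ ⟨h1, h2, a, b, h3, h4⟩
    refine ⟨?_, fun s => ?_, r • a, r • b, fun g => ?_, fun g => ?_⟩
    · change H1π _ (r • d) ∈ _
      rw [map_smul]
      exact Submodule.smul_mem _ _ h1
    · change derToDerOneₗ ρ N (r • d s) = derOneRep ρ N s (r • α) - r • α
      rw [map_smul, h2, map_smul, smul_sub]
    · change derOneRep ρ N g (r • α) - r • α =
        derSharpToDerOneₗ ρ N (r • a g) + derToDerOneₗ ρ N (r • b g)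
      rw [map_smul, map_smul, map_smul, ← smul_add, ← h3, smul_sub]
    · change r • c g = (toDerQuot ρ N).hom (r • a g)
      rw [map_smul, h4]

/-- The map `(d, α, c) ↦ [d]`. -/
noncomputable def gammaSource : gammaData ρ N →ₗ[k] invH1 (Der ρ) N :=
  LinearMap.codRestrict (invH1 (Der ρ) N) ((H1π (Rep.res N.subtype (Der ρ))).hom ∘ₗ
    LinearMap.fst k _ _ ∘ₗ (gammaData ρ N).subtype) fun x => x.2.1

/-- The map `(d, α, c) ↦ -[c]`. -/
noncomputable def gammaTarget : gammaData ρ N →ₗ[k] H1 (DerQuot ρ N) :=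
  -((H1π (DerQuot ρ N)).hom ∘ₗ LinearMap.snd k _ _ ∘ₗ LinearMap.snd k _ _ ∘ₗ
    (gammaData ρ N).subtype)

variable {ρ N} (hι : Function.Injective (derToDerOne ρ N))
  (hcob : ∀ d : cocycles₁ (Rep.res N.subtype (Der ρ)), ∃ α : DerOne ρ N, ∀ s : N,
    derToDerOneₗ ρ N (d s) = derOneRep ρ N s α - α)

include hι hcob in
theorem gammaSource_surjective : Function.Surjective (gammaSource ρ N) := by
  rintro ⟨κ, hκ⟩
  induction κ using H1_induction_on with | @h d =>
  obtain ⟨α, hα⟩ := hcob d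
  obtain ⟨a, b, hab⟩ := exists_sharp_of_mem_invH1 hκ hα
  obtain ⟨c, hc⟩ := exists_cocycle_derQuot hι hα hab
  exact ⟨⟨(d, α, c), hκ, hα, a, b, hab, hc⟩, rfl⟩

include hι in
-- By linearity this gives independence of all choices at once. If `d_s = m^s - m`, then `α - m` is
-- `N`-invariant, hence some `e` in `Der^♯`, and `e^g - e - a_g = b_g - (m^g - m)` lies in `Der ∩
-- Der^♯`. So `ā` is the coboundary of the class of `e`.
theorem gammaTarget_eq_zero (x : gammaData ρ N) (h : gammaSource ρ N x = 0) :
    gammaTarget ρ N x = 0 := by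
  obtain ⟨⟨d, α, c⟩, h1, h2, a, b, h3, h4⟩ := x
  change H1π _ d ∈ _ at h1
  change ∀ s : N, derToDerOneₗ ρ N (d s) = derOneRep ρ N s α - α at h2
  change ∀ g : G, derOneRep ρ N g α - α =
    derSharpToDerOneₗ ρ N (a g) + derToDerOneₗ ρ N (b g) at h3
  change ∀ g : G, c g = _ at h4
  have h0 : H1π (Rep.res N.subtype (Der ρ)) d = 0 := congrArg Subtype.val h
  obtain ⟨m, hm⟩ := (H1π_eq_zero_iff_exists d).1 h0
  obtain ⟨e, he⟩ := exists_derSharpToDerOne_eq (α := α - derToDerOneₗ ρ N m) fun s => by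
    have h5 : d s = (Der ρ).ρ s m - m := (hm s).symm
    have h6 := h2 s
    rw [h5, map_sub, ← derOneRep_derToDerOneₗ] at h6
    rw [map_sub, ← sub_eq_zero, ← sub_eq_zero.2 h6.symm]
    abel
  change derSharpToDerOneₗ ρ N e = _ at he
  change -(H1π _ c) = 0
  rw [neg_eq_zero, H1π_eq_zero_iff_exists]
  refine ⟨(toDerQuot ρ N).hom e, fun q => ?_⟩
  induction q using QuotientGroup.induction_on with | @H g =>
  rw [h4]
  have := toDerQuot_eq_zero hι (e := (DerSharp ρ N).ρ (g : G ⧸ N) e - e - a g)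
    (d := b g - ((Der ρ).ρ g m - m)) (by
      rw [map_sub, map_sub, map_sub, map_sub, ← derOneRep_derSharpToDerOneₗ,
        ← derOneRep_derToDerOneₗ, he, map_sub, eq_sub_iff_add_eq.2 (h3 g).symm]
      abel)
  rw [map_sub, map_sub, sub_eq_zero] at this
  exact this

/-- The map `γ : H¹(N, Der)^{G/N} → H¹(G/N, Der^♯/Der^N)`, `[d] ↦ -[ā]`. -/
noncomputable def gamma : invH1 (Der ρ) N →ₗ[k] H1 (DerQuot ρ N) :=
  descend (M := gammaData ρ N) (P := invH1 (Der ρ) N) (Q := H1 (DerQuot ρ N))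
    (gammaSource ρ N) (gammaTarget ρ N) (gammaSource_surjective hι hcob) (gammaTarget_eq_zero hι)

theorem gamma_apply (x : gammaData ρ N) :
    gamma hι hcob (gammaSource ρ N x) = gammaTarget ρ N x := by
  rw [gamma, descend_apply]

theorem gamma_eq {d : cocycles₁ (Rep.res N.subtype (Der ρ))} (hd : H1π _ d ∈ invH1 (Der ρ) N)
    {α : DerOne ρ N} {a : G → DerSharp ρ N} {b : G → Der ρ} {c : cocycles₁ (DerQuot ρ N)}
    (hα : ∀ s : N, derToDerOneₗ ρ N (d s) = derOneRep ρ N s α - α)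
    (hab : ∀ g : G, derOneRep ρ N g α - α =
      derSharpToDerOneₗ ρ N (a g) + derToDerOneₗ ρ N (b g))
    (hc : ∀ g : G, c (g : G ⧸ N) = (toDerQuot ρ N).hom (a g)) :
    gamma hι hcob ⟨H1π _ d, hd⟩ = -H1π _ c :=
  gamma_apply hι hcob ⟨(d, α, c), hd, hα, a, b, hab, hc⟩

end Gamma

/-! ### Induced cocycles, and the squares involving `γ`. -/

section Induction

open groupCohomology CategoryTheory

variable {k G B : Type u} [Field k] [Group G] [CommRing B] [Algebra k B]
  {ρ : G →* (B ≃ₐ[k] B)} {N : Subgroup G} [N.Normal]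

/-- The cocycle `e` of `G/N` in `Der^♯` is induced by the cocycle `d` of `G` in `Der`, by means of
the element `α` of `Der_1`: `e_g = α^g - α + d_g` in `Der_1` for all `g`. -/
def IsInduced (d : cocycles₁ (Der ρ)) (e : cocycles₁ (DerSharp ρ N)) (α : DerOne ρ N) : Prop :=
  ∀ g : G, derSharpToDerOneₗ ρ N (e (g : G ⧸ N)) =
    derOneRep ρ N g α - α + derToDerOneₗ ρ N (d g)

variable {d d' : cocycles₁ (Der ρ)} {e e' : cocycles₁ (DerSharp ρ N)} {α α' : DerOne ρ N}

theorem IsInduced.add (h : IsInduced d e α) (h' : IsInduced d' e' α') :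
    IsInduced (d + d') (e + e') (α + α') := fun g => by
  change derSharpToDerOneₗ ρ N (e g + e' g) = _ - _ + derToDerOneₗ ρ N (d g + d' g)
  rw [map_add, h, h', map_add, map_add]
  abel

theorem IsInduced.smul (h : IsInduced d e α) (r : k) : IsInduced (r • d) (r • e) (r • α) :=
  fun g => by
    change derSharpToDerOneₗ ρ N (r • e g) = _ - _ + derToDerOneₗ ρ N (r • d g)
    rw [map_smul, h, map_smul, map_smul, smul_add, smul_sub]

theorem cocycles₁_coe_eq_zero {A : Rep k (G ⧸ N)} (e : cocycles₁ A) (s : N) :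
    e ((s : G) : G ⧸ N) = 0 := by
  rw [(QuotientGroup.eq_one_iff (s : G)).2 s.2, cocycles₁_map_one]

/-- If `d - d'` is the coboundary of `m`, then `e - e'` is the coboundary of `α - α' + m` in
`Der_1`. Cocycles of `G/N` vanish on `N`, so this element is `N`-invariant and lies in `Der^♯`,
where it bounds `e - e'`. -/
theorem IsInduced.H1π_eq (h : IsInduced d e α) (h' : IsInduced d' e' α')
    (hd : H1π _ d = H1π _ d') : H1π _ e = H1π _ e' := by
  obtain ⟨m, hm⟩ := (H1π_eq_iff_exists d d').1 hd
  have hβ : ∀ g : G, derOneRep ρ N g (α - α' + derToDerOneₗ ρ N m) -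
      (α - α' + derToDerOneₗ ρ N m) = derSharpToDerOneₗ ρ N (e g - e' g) := fun g => by
    have hm' := congrArg (derToDerOneₗ ρ N) (hm g)
    rw [map_sub, map_sub] at hm'
    rw [map_sub, h, h', map_add, derOneRep_derToDerOneₗ, map_sub, eq_add_of_sub_eq hm']
    abel
  obtain ⟨m', hm'⟩ := exists_derSharpToDerOne_eq (α := α - α' + derToDerOneₗ ρ N m) fun s => by
    rw [← sub_eq_zero, hβ, cocycles₁_coe_eq_zero, cocycles₁_coe_eq_zero, sub_self, map_zero]
  refine (H1π_eq_iff_exists e e').2 ⟨m', fun q => ?_⟩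
  induction q using QuotientGroup.induction_on with | @H g =>
  refine derSharpToDerOneₗ_injective ?_
  rw [← hβ, ← hm', map_sub]
  rfl

theorem mapH1Sharp_H1π (c : cocycles₁ (DerInv ρ N)) :
    ∃ e : cocycles₁ (DerSharp ρ N), (∀ q, e q = (restrictDer ρ N).hom (c q)) ∧
      mapH1Sharp ρ N (H1π _ c) = H1π _ e := by
  refine ⟨⟨fun q => (restrictDer ρ N).hom (c q), (mem_cocycles₁_iff _).2 fun q r => ?_⟩,
    fun _ => rfl, ?_⟩
  · rw [(mem_cocycles₁_iff c).1 c.2, map_add, Rep.hom_comm_apply]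
  · rw [mapH1Sharp]
    erw [H1π_comp_map_apply (MonoidHom.id (G ⧸ N))]
    rfl

theorem sigmaH1_H1π (e : cocycles₁ (DerSharp ρ N)) :
    ∃ c : cocycles₁ (DerQuot ρ N), (∀ q, c q = (toDerQuot ρ N).hom (e q)) ∧
      sigmaH1 ρ N (H1π _ e) = H1π _ c := by
  refine ⟨⟨fun q => (toDerQuot ρ N).hom (e q), (mem_cocycles₁_iff _).2 fun q r => ?_⟩,
    fun _ => rfl, ?_⟩
  · rw [(mem_cocycles₁_iff e).1 e.2, map_add, Rep.hom_comm_apply]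
  · rw [sigmaH1]
    erw [H1π_comp_map_apply (MonoidHom.id (G ⧸ N))]
    rfl

variable (hι : Function.Injective (derToDerOne ρ N))
  (hcob : ∀ d : cocycles₁ (Rep.res N.subtype (Der ρ)), ∃ α : DerOne ρ N, ∀ s : N,
    derToDerOneₗ ρ N (d s) = derOneRep ρ N s α - α)

/-- On `N` the cocycle `e` vanishes, so `-α` cobounds the restriction of `d`; on `G` the coboundary
of `-α` decomposes as `-e + d`. The sign in the definition of `γ` turns `-[ē]` into `[ē]`. -/
theorem IsInduced.sigmaH1_eq (h : IsInduced d e α) :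
    sigmaH1 ρ N (H1π _ e) = gamma hι hcob (resInv (Der ρ) N (H1π _ d)) := by
  obtain ⟨d', hd', hr⟩ := resInv_H1π (Der ρ) N d
  obtain ⟨c, hc, hs⟩ := sigmaH1_H1π e
  have hmem : H1π _ d' ∈ invH1 (Der ρ) N := hr ▸ (resInv (Der ρ) N (H1π _ d)).2
  have hx : resInv (Der ρ) N (H1π _ d) = ⟨H1π _ d', hmem⟩ := Subtype.ext hr
  rw [hx, hs, gamma_eq hι hcob hmem (α := -α) (a := fun g => -e g) (b := d) (c := -c),
    map_neg, neg_neg]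
  · intro s
    have h1 := h s
    rw [cocycles₁_coe_eq_zero, map_zero] at h1
    rw [hd', map_neg, ← sub_eq_zero, h1]
    abel
  · intro g
    rw [map_neg, map_neg, h]
    abel
  · intro g
    change -c g = _
    rw [hc, map_neg]

/-- The same cochain `b` is used for the transgression and for the decomposition of `α^g - α`. -/
theorem δ_gamma (hS : (derSeq ρ N).ShortExact) (x : invH1 (Der ρ) N) :
    transgression (Der ρ) N x = (δ hS 1 2 rfl).hom (gamma hι hcob x) := by
  obtain ⟨d, b, c, hb, hc, hxd, htr⟩ := exists_transgression_eq x
  have hx : (d, b, c) ∈ transgressionData (Der ρ) N := ⟨hb, hc⟩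
  have hmem : H1π _ d ∈ invH1 (Der ρ) N := hxd ▸ x.2
  obtain rfl : x = ⟨H1π _ d, hmem⟩ := Subtype.ext hxd
  obtain ⟨α, hα⟩ := hcob d
  obtain ⟨a, ha⟩ := exists_sharp (b := b) hα (fun g s => (extends_mul hx g s).1)
    (fun g s => (extends_mul hx g s).2)
  obtain ⟨z, hz⟩ := exists_cocycle_derQuot hι hα ha
  rw [htr, gamma_eq hι hcob hmem hα ha hz, ← map_neg]
  -- The cochain `-a` lifts `-z`. In `Der_1` it equals `b` minus a coboundary, so its coboundary is
  -- that of `b`, namely `c`.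
  refine ((δ₁_apply hS (-z) (fun q => -a q) (funext fun q => ?_) c (funext fun q => ?_))).symm
  · induction q using QuotientGroup.induction_on with | @H g =>
    refine Eq.trans ?_ (congrArg Neg.neg (hz g).symm)
    exact map_neg (toDerQuot ρ N).hom (a g)
  · obtain ⟨q, r⟩ := q
    induction q using QuotientGroup.induction_on with | @H g =>
    induction r using QuotientGroup.induction_on with | @H h =>
    refine derSharpToDerOneₗ_injective ?_
    change derToDerOneₗ ρ N (c (g, h)).1 = derSharpToDerOneₗ ρ N
      ((DerSharp ρ N).ρ (g : G ⧸ N) (-a h) - -a ((g * h : G) : G ⧸ N) + -a g)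
    have h1 := eq_sub_iff_add_eq.2 (ha (g * h)).symm
    have h2 := eq_sub_iff_add_eq.2 (ha h).symm
    have h3 := eq_sub_iff_add_eq.2 (ha g).symm
    rw [hc, map_add, map_sub, map_add, map_sub, ← derOneRep_derSharpToDerOneₗ,
      map_neg (derSharpToDerOneₗ ρ N), map_neg (derSharpToDerOneₗ ρ N),
      map_neg (derSharpToDerOneₗ ρ N), h1, h2, h3, ← derOneRep_derToDerOneₗ, map_neg, map_sub, map_sub, derOneRep_mul]
    abel

end Induction

/-! ### The map `ind` on cocycles, and exactness of the lower row. -/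

section PowerSeries

open groupCohomology CategoryTheory TrivSqZeroExt

variable {k G : Type u} [Field k] [Group G] [Finite G] {ρ : G →* (k⟦X⟧ ≃ₐ[k] k⟦X⟧)}
  (N : Subgroup G) [N.Normal] (hρ : Function.Injective ρ)

omit [N.Normal] in
theorem snd_trivHom (σ : Lift ρ) (w : (fixed ρ N)[ε]) :
    (trivHom σ N hρ w).snd = (trivHom σ N hρ (inl w.fst)).snd + w.snd := by
  rw [trivHom_apply, trivHom_apply]
  simp [fst_substNormLift_symm]

/-- Here `α` is the `ε`-part of the trivialization of the deformed fixed ring. Since the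
trivialization intertwines the induced action with `σ`, comparing `ε`-parts at `z = ρ(g)⁻¹(x)` gives
`α(x) + e_g(x) = α^g(x) + d_g(x)`. -/
theorem isInduced_induced (σ : Lift ρ) :
    ∃ α : DerOne ρ N, IsInduced σ.cocycle (σ.induced N hρ).cocycle α := by
  let α : DerOne ρ N := Derivation.mk'
    { toFun := fun x => (trivHom σ N hρ (inl x)).snd
      map_add' := fun x y => by rw [inl_add, map_add, snd_add]
      map_smul' := fun c x => by rw [inl_smul, map_smul, snd_smul]; rfl }
    fun x y => by
      change (trivHom σ N hρ (inl (x * y))).snd = x.1 • (trivHom σ N hρ (inl y)).snd +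
        y.1 • (trivHom σ N hρ (inl x)).snd
      rw [inl_mul, map_mul, snd_mul, fst_trivHom, fst_trivHom, op_smul_eq_smul]
      rfl
  refine ⟨α, fun g => Derivation.ext fun x => ?_⟩
  set z := (quotientAction ρ N (g : G ⧸ N)).symm x with hz
  have hz' : ρ g z = x :=
    congrArg Subtype.val ((quotientAction ρ N (g : G ⧸ N)).apply_symm_apply x)
  set w := (σ.induced N hρ).hom g (inl z) with hw
  have hw1 : w.fst = x := by
    rw [hw, (σ.induced N hρ).fst_hom]
    exact (quotientAction ρ N (g : G ⧸ N)).apply_symm_apply x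
  have h1 := congrArg TrivSqZeroExt.snd (induced_spec σ N hρ g (inl z))
  rw [← hw, snd_trivHom, hw1, ← σ.liftAut_cocycle g, snd_liftAut, fst_trivHom, fst_inl, hz'] at h1
  change (w.snd : k⟦X⟧) = ρ g (trivHom σ N hρ (inl z)).snd - (trivHom σ N hρ (inl x)).snd +
    (σ.cocycle g : Derivation k k⟦X⟧ k⟦X⟧) x
  linear_combination h1

theorem exists_isInduced (d : cocycles₁ (Der ρ)) :
    ∃ (e : cocycles₁ (DerSharp ρ N)) (α : DerOne ρ N), IsInduced d e α ∧
      indH1 ρ N hρ (H1π _ d) = H1π _ e := by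
  obtain ⟨α, hα⟩ := isInduced_induced N hρ (liftOfCocycle d)
  rw [cocycle_liftOfCocycle] at hα
  refine ⟨_, α, hα, ?_⟩
  have h : (tangentEquiv ρ).symm (H1π _ d) = Quotient.mk (Lift.setoid ρ) (liftOfCocycle d) :=
    (Equiv.symm_apply_eq _).2 (congrArg (H1π (Der ρ)) (cocycle_liftOfCocycle d)).symm
  rw [indH1, h]
  rfl

variable {N} in
-- Any solution `(e, α)` of the relation computes `ind`, not only the one coming from the norm of
-- `t`.
theorem indH1_eq {d : cocycles₁ (Der ρ)} {e : cocycles₁ (DerSharp ρ N)} {α : DerOne ρ N}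
    (h : IsInduced d e α) : indH1 ρ N hρ (H1π _ d) = H1π _ e := by
  obtain ⟨e', α', h', hi⟩ := exists_isInduced N hρ d
  rw [hi, h'.H1π_eq h rfl]

theorem isLinearMap_indH1 : IsLinearMap k (indH1 ρ N hρ) where
  map_add κ κ' := by
    induction κ using H1_induction_on with | @h d =>
    induction κ' using H1_induction_on with | @h d' =>
    obtain ⟨e, α, h, hi⟩ := exists_isInduced N hρ d
    obtain ⟨e', α', h', hi'⟩ := exists_isInduced N hρ d'
    rw [← map_add, hi, hi', indH1_eq hρ (h.add h'), map_add]
  map_smul r κ := by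
    induction κ using H1_induction_on with | @h d =>
    obtain ⟨e, α, h, hi⟩ := exists_isInduced N hρ d
    rw [← map_smul, hi, indH1_eq hρ (h.smul r), map_smul]

theorem indH1_inflation (x : H1 (DerInv ρ N)) :
    indH1 ρ N hρ (inflation (Der ρ) N 1 x) = mapH1Sharp ρ N x := by
  induction x using H1_induction_on with | @h c =>
  obtain ⟨d, hd, hi⟩ := inflation_H1π (Der ρ) N c
  obtain ⟨e, he, hm⟩ := mapH1Sharp_H1π c
  rw [hi, hm]
  -- An inflated cocycle takes values in `Der^N`, where restriction to `k⟦t⟧^N` already lands in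
  -- `Der^♯`; no correction `α` is needed.
  refine indH1_eq (α := 0) hρ fun g => ?_
  rw [hd, he, map_zero]
  refine Eq.trans ?_ (congrArg (· + _) (sub_zero (0 : DerOne ρ N)).symm)
  refine Eq.trans ?_ (zero_add _).symm
  rfl

include hρ in
theorem exact_mapH1Sharp_sigmaH1 : Function.Exact (mapH1Sharp ρ N) (sigmaH1 ρ N) :=
  (ShortComplex.ShortExact.moduleCat_exact_iff_function_exact _).1
    (mapShortComplex₂_exact (derSeq_shortExact ρ N hρ) 1)

theorem exact_sigmaH1_boundaryH1 : Function.Exact (sigmaH1 ρ N) (boundaryH1 ρ hρ N) :=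
  (ShortComplex.ShortExact.moduleCat_exact_iff_function_exact _).1
    (mapShortComplex₃_exact (derSeq_shortExact ρ N hρ) (rfl : 1 + 1 = 2))

end PowerSeries

end LocalAction

theorem mainTheorem4 {k G : Type u} [Field k] (p : ℕ) [Fact p.Prime] [CharP k p]
    [PerfectField k] [Group G] [Finite G] (ρ : G →* (k⟦X⟧ ≃ₐ[k] k⟦X⟧))
    (hρ : Function.Injective ρ) (N : Subgroup G) [N.Normal] :
    -- the upper row is exact
    (Function.Injective (LocalAction.inflation (LocalAction.Der ρ) N 1) ∧
      Function.Exact (LocalAction.inflation (LocalAction.Der ρ) N 1)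
        (LocalAction.resInv (LocalAction.Der ρ) N) ∧
      Function.Exact (LocalAction.resInv (LocalAction.Der ρ) N)
        (LocalAction.transgression (LocalAction.Der ρ) N) ∧
      Function.Exact (LocalAction.transgression (LocalAction.Der ρ) N)
        (LocalAction.inflation (LocalAction.Der ρ) N 2)) ∧
    -- the lower row is exact
    (Function.Exact (LocalAction.mapH1Sharp ρ N) (LocalAction.sigmaH1 ρ N) ∧
      Function.Exact (LocalAction.sigmaH1 ρ N) (LocalAction.boundaryH1 ρ hρ N)) ∧
    -- the map `ind` is linear
    IsLinearMap k (LocalAction.indH1 ρ N hρ) ∧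
    -- every cocycle `d : N → Der` is of the form `s ↦ α^s - α` with `α ∈ Der_1`
    (∀ d : groupCohomology.cocycles₁ (Rep.res N.subtype (LocalAction.Der ρ)),
      ∃ α : LocalAction.DerOne ρ N, ∀ s : N,
        LocalAction.derToDerOne ρ N (d s) = LocalAction.derOneRep ρ N s α - α) ∧
    -- if the class of `d` is invariant, then `α^g - α = a_g + b_g`, `a_g ∈ Der^♯`, `b_g ∈ Der`
    (∀ (d : groupCohomology.cocycles₁ (Rep.res N.subtype (LocalAction.Der ρ)))
      (α : LocalAction.DerOne ρ N),
      groupCohomology.H1π _ d ∈ LocalAction.invH1 (LocalAction.Der ρ) N →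
      (∀ s : N, LocalAction.derToDerOne ρ N (d s) = LocalAction.derOneRep ρ N s α - α) →
      ∃ (a : G → LocalAction.DerSharp ρ N) (b : G → LocalAction.Der ρ), ∀ g : G,
        LocalAction.derOneRep ρ N g α - α =
          LocalAction.derSharpToDerOne ρ N (a g) + LocalAction.derToDerOne ρ N (b g)) ∧
    ∃ γ : LocalAction.invH1 (LocalAction.Der ρ) N →ₗ[k]
        groupCohomology.H1 (LocalAction.DerQuot ρ N),
      -- `γ` is given by `γ[d] = -[ā]`
      (∀ (d : groupCohomology.cocycles₁ (Rep.res N.subtype (LocalAction.Der ρ)))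
        (hd : groupCohomology.H1π _ d ∈ LocalAction.invH1 (LocalAction.Der ρ) N)
        (α : LocalAction.DerOne ρ N) (a : G → LocalAction.DerSharp ρ N)
        (b : G → LocalAction.Der ρ),
        (∀ s : N, LocalAction.derToDerOne ρ N (d s) = LocalAction.derOneRep ρ N s α - α) →
        (∀ g : G, LocalAction.derOneRep ρ N g α - α =
          LocalAction.derSharpToDerOne ρ N (a g) + LocalAction.derToDerOne ρ N (b g)) →
        ∃ c : groupCohomology.cocycles₁ (LocalAction.DerQuot ρ N),
          (∀ g : G, c (g : G ⧸ N) = (LocalAction.toDerQuot ρ N).hom (a g)) ∧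
          γ ⟨groupCohomology.H1π _ d, hd⟩ = -groupCohomology.H1π _ c) ∧
      -- the three squares commute
      (∀ x, LocalAction.indH1 ρ N hρ (LocalAction.inflation (LocalAction.Der ρ) N 1 x) =
        LocalAction.mapH1Sharp ρ N x) ∧
      (∀ x, LocalAction.sigmaH1 ρ N (LocalAction.indH1 ρ N hρ x) =
        γ (LocalAction.resInv (LocalAction.Der ρ) N x)) ∧
      (∀ x, LocalAction.transgression (LocalAction.Der ρ) N x =
        LocalAction.boundaryH1 ρ hρ N (γ x)) := by
  -- This and the next line are the two properties of `k⟦t⟧` on which the construction of `γ` rests.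
  have hι := LocalAction.derToDerOne_injective (N := N) hρ
  have hcob := LocalAction.exists_cobounding ρ N hρ
  refine ⟨⟨LocalAction.inflation_injective _ N, LocalAction.exact_inflation_resInv _ N,
    LocalAction.exact_resInv_transgression _ N, LocalAction.exact_transgression_inflation _ N⟩,
    ⟨LocalAction.exact_mapH1Sharp_sigmaH1 N hρ, LocalAction.exact_sigmaH1_boundaryH1 N hρ⟩,
    LocalAction.isLinearMap_indH1 N hρ, hcob,
    fun d α hd hα => LocalAction.exists_sharp_of_mem_invH1 hd hα,
    LocalAction.gamma hι hcob, fun d hd α a b hα hab => ?_, LocalAction.indH1_inflation N hρ,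
    fun x => ?_, LocalAction.δ_gamma hι hcob (LocalAction.derSeq_shortExact ρ N hρ)⟩
  · obtain ⟨c, hc⟩ := LocalAction.exists_cocycle_derQuot hι hα hab
    exact ⟨c, hc, LocalAction.gamma_eq hι hcob hd hα hab hc⟩
  · induction x using groupCohomology.H1_induction_on with | @h d =>
    obtain ⟨e, α, h, hi⟩ := LocalAction.exists_isInduced N hρ d
    rw [hi]
    exact h.sigmaH1_eq hι hcob
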